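/- Let $n\ge 0$ and let $\mathbb Q\langle X_n\rangle=\mathbb Q\langle x_1,\dots,x_n\rangle$ be the ring of polynomials in $n$ noncommuting variables, on which $GL_n(\mathbb Q)$ acts by linear substitution of the variables. For a variable $x$ let $\partial_x$ be the Hausdorff derivative: the linear map sending a word $w$ to the sum, over all occurrences of the letter $x$ in $w$, of the word obtained from $w$ by deleting that occurrence. Let $$\mathcal A'_n=\bigcap_{x\in\{x_1,\dots,x_n\}}\ker\partial_x\subseteq\mathbb Q\langle X_n\rangle ,$$ the realization inside $\mathbb Q\langle X_n\rangle$ of the enveloping algebra of the derived free Lie algebra on $x_1,\dots,x_n$. It is a $GL_n(\mathbb Q)$-stable graded subspace with finite-dimensional homogeneous components. Its $GL_n(\mathbb Q)$-character is the formal power series in $a_1,\dots,a_n$ obtained by summing, over all degrees $k\ge0$, the polynomial in $a_1,\dots,a_n$ that gives the trace of $\mathrm{diag}(a_1,\dots,a_n)$ on the homogeneous component of degree $k$. Then, as formal power series, $$\mathrm{char}_{GL_n(\mathbb Q)}(\mathcal A'_n)(a_1,\dots,a_n)=\frac{(1-a_1)\cdots(1-a_n)}{1-(a_1+\cdots+a_n)}=1+\sum_{k\ge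 0}\ \sum_{i=2}^{k}(-1)^i\,e_{(i,1^{k-i})}(a_1,\dots,a_n),$$ where $e_{(i,1^{k-i})}=e_i\,e_1^{\,k-i}$ is a product of elementary symmetric polynomials (the inner sum is empty for $k<2$). Moreover this series is equal to $$\sum_T s_{\mathrm{shape}(T)}(a_1,\dots,a_n),$$ where $s_\lambda$ is the Schur polynomial (zero if $\lambda$ has more than $n$ rows) and the sum is over all standard Young tableaux $T$ (of every size, including the empty tableau) such that the smallest positive integer which does not appear in the first column of $T$ is odd. -/

import Mathlib

open scoped MvPowerSeries.WithPiTopology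

noncomputable section

namespace NCHarm

/-! ### Noncommutative polynomials and the Hausdorff derivatives -/

/-- The monomial `x_{w₁} x_{w₂} ⋯ x_{w_r}` of `ℚ⟨x₁, …, x_n⟩`. -/
def wordMonomial {n : ℕ} (w : List (Fin n)) : FreeAlgebra ℚ (Fin n) :=
  (w.map (FreeAlgebra.ι ℚ)).prod

/-- The Hausdorff derivative `∂_x`: the linear map sending a word `w` to the sum, over all
occurrences of the letter `x` in `w`, of the word `w` with that occurrence deleted. -/
def hausdorffDerivative {n : ℕ} (x : Fin n) :
    FreeAlgebra ℚ (Fin n) →ₗ[ℚ] FreeAlgebra ℚ (Fin n) :=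
  (FreeAlgebra.basisFreeMonoid ℚ (Fin n)).constr ℚ fun w =>
    ∑ i : Fin w.toList.length,
      if w.toList.get i = x then wordMonomial (w.toList.eraseIdx i) else 0

theorem basisFreeMonoid_eq_wordMonomial {n : ℕ} (w : FreeMonoid (Fin n)) :
    FreeAlgebra.basisFreeMonoid ℚ (Fin n) w = wordMonomial w.toList := by
  simp [FreeAlgebra.basisFreeMonoid, wordMonomial, FreeAlgebra.equivMonoidAlgebraFreeMonoid,
    FreeMonoid.lift_apply]

theorem hausdorffDerivative_wordMonomial {n : ℕ} (x : Fin n) (w : List (Fin n)) :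
    hausdorffDerivative x (wordMonomial w) =
      ∑ i : Fin w.length, if w.get i = x then wordMonomial (w.eraseIdx i) else 0 := by
  have h := basisFreeMonoid_eq_wordMonomial (FreeMonoid.ofList w)
  rw [FreeMonoid.toList_ofList] at h
  rw [← h, hausdorffDerivative, Module.Basis.constr_basis]
  rfl

theorem hausdorffDerivative_one {n : ℕ} (x : Fin n) : hausdorffDerivative x 1 = 0 := by
  have h := hausdorffDerivative_wordMonomial x []
  simpa [wordMonomial] using h

theorem linearMap_ext_wordMonomial {n : ℕ} {M : Type*} [AddCommGroup M] [Module ℚ M]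
    {φ ψ : FreeAlgebra ℚ (Fin n) →ₗ[ℚ] M}
    (h : ∀ w : List (Fin n), φ (wordMonomial w) = ψ (wordMonomial w)) : φ = ψ := by
  refine (FreeAlgebra.basisFreeMonoid ℚ (Fin n)).ext fun w => ?_
  rw [basisFreeMonoid_eq_wordMonomial, h]

theorem hausdorffDerivative_ι_mul {n : ℕ} (x y : Fin n) (f : FreeAlgebra ℚ (Fin n)) :
    hausdorffDerivative x (FreeAlgebra.ι ℚ y * f) =
      (if y = x then f else 0) + FreeAlgebra.ι ℚ y * hausdorffDerivative x f := by
  have key : (hausdorffDerivative x) ∘ₗ (LinearMap.mulLeft ℚ (FreeAlgebra.ι ℚ y)) =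
      (if y = x then LinearMap.id else 0) +
        (LinearMap.mulLeft ℚ (FreeAlgebra.ι ℚ y)) ∘ₗ (hausdorffDerivative x) := by
    apply linearMap_ext_wordMonomial
    intro w
    have e : FreeAlgebra.ι ℚ y * wordMonomial w = wordMonomial (y :: w) := by
      simp [wordMonomial]
    simp only [LinearMap.comp_apply, LinearMap.mulLeft_apply, LinearMap.add_apply, e,
      hausdorffDerivative_wordMonomial]
    refine (Fin.sum_univ_succ (n := w.length) fun i =>
      if (y :: w).get i = x then wordMonomial ((y :: w).eraseIdx i) else 0).trans ?_
    congr 1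
    · split_ifs <;> simp_all
    · rw [Finset.mul_sum]
      refine Finset.sum_congr rfl fun i _ => ?_
      split_ifs <;> simp_all [wordMonomial]
  have := LinearMap.congr_fun key f
  simp only [LinearMap.comp_apply, LinearMap.mulLeft_apply, LinearMap.add_apply] at this
  rw [this]
  split_ifs <;> simp

theorem hausdorffDerivative_ι {n : ℕ} (x y : Fin n) :
    hausdorffDerivative x (FreeAlgebra.ι ℚ y) = if y = x then 1 else 0 := by
  have h := hausdorffDerivative_ι_mul x y 1
  simpa [hausdorffDerivative_one] using h

theorem hausdorffDerivative_mul {n : ℕ} (x : Fin n) (f g : FreeAlgebra ℚ (Fin n)) :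
    hausdorffDerivative x (f * g) =
      hausdorffDerivative x f * g + f * hausdorffDerivative x g := by
  have key : (hausdorffDerivative x) ∘ₗ (LinearMap.mulRight ℚ g) =
      (LinearMap.mulRight ℚ g) ∘ₗ (hausdorffDerivative x) +
        LinearMap.mulRight ℚ (hausdorffDerivative x g) := by
    apply linearMap_ext_wordMonomial
    intro w
    simp only [LinearMap.comp_apply, LinearMap.mulRight_apply, LinearMap.add_apply]
    induction w with
    | nil => simp [wordMonomial, hausdorffDerivative_one]
    | cons y w ih =>
      have e : wordMonomial (y :: w) = FreeAlgebra.ι ℚ y * wordMonomial w := by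
        simp [wordMonomial]
      rw [e, mul_assoc, hausdorffDerivative_ι_mul, ih, hausdorffDerivative_ι_mul]
      split_ifs <;> noncomm_ring
  exact LinearMap.congr_fun key f

/-! ### The action of `GL_n(ℚ)` and the module `𝒜'_n` -/

/-- The algebra endomorphism of `ℚ⟨x₁, …, x_n⟩` with `x_j ↦ ∑ i, g i j • x_i`. -/
def substHom {n : ℕ} (g : Matrix (Fin n) (Fin n) ℚ) :
    FreeAlgebra ℚ (Fin n) →ₐ[ℚ] FreeAlgebra ℚ (Fin n) :=
  FreeAlgebra.lift ℚ fun j => ∑ i, g i j • FreeAlgebra.ι ℚ i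

theorem substHom_ι {n : ℕ} (g : Matrix (Fin n) (Fin n) ℚ) (j : Fin n) :
    substHom g (FreeAlgebra.ι ℚ j) = ∑ i, g i j • FreeAlgebra.ι ℚ i := by
  simp [substHom]

/-- The canonical action of `GL_n(ℚ)` on `ℚ⟨x₁, …, x_n⟩` by linear substitutions. -/
def glRep (n : ℕ) : Representation ℚ (GL (Fin n) ℚ) (FreeAlgebra ℚ (Fin n)) where
  toFun g := (substHom (g : Matrix (Fin n) (Fin n) ℚ)).toLinearMap
  map_one' := by
    have : substHom (1 : Matrix (Fin n) (Fin n) ℚ) = AlgHom.id ℚ _ := by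
      apply FreeAlgebra.hom_ext
      funext j
      simp [substHom_ι, Matrix.one_apply]
    simp only [Units.val_one, this]
    rfl
  map_mul' g h := by
    have : substHom ((g : Matrix (Fin n) (Fin n) ℚ) * (h : Matrix (Fin n) (Fin n) ℚ)) =
        (substHom (g : Matrix (Fin n) (Fin n) ℚ)).comp
          (substHom (h : Matrix (Fin n) (Fin n) ℚ)) := by
      apply FreeAlgebra.hom_ext
      funext j
      simp only [Function.comp_apply, AlgHom.comp_apply, substHom_ι, map_sum, map_smul,
        Matrix.mul_apply, Finset.sum_smul, Finset.smul_sum]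
      rw [Finset.sum_comm]
      refine Finset.sum_congr rfl fun l _ => Finset.sum_congr rfl fun i _ => ?_
      rw [smul_smul, mul_comm]
    simp only [Units.val_mul, this]
    rfl

theorem glRep_mul {n : ℕ} (g : GL (Fin n) ℚ) (f h : FreeAlgebra ℚ (Fin n)) :
    glRep n g (f * h) = glRep n g f * glRep n g h :=
  map_mul (substHom (g : Matrix (Fin n) (Fin n) ℚ)) f h

theorem glRep_ι {n : ℕ} (g : GL (Fin n) ℚ) (j : Fin n) :
    glRep n g (FreeAlgebra.ι ℚ j) =
      ∑ i, (g : Matrix (Fin n) (Fin n) ℚ) i j • FreeAlgebra.ι ℚ i :=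
  substHom_ι _ j

theorem glRep_algebraMap {n : ℕ} (g : GL (Fin n) ℚ) (r : ℚ) :
    glRep n g (algebraMap ℚ _ r) = algebraMap ℚ _ r :=
  (substHom (g : Matrix (Fin n) (Fin n) ℚ)).commutes r

/-- Chain rule. -/
theorem hausdorffDerivative_glRep {n : ℕ} (g : GL (Fin n) ℚ) (x : Fin n)
    (f : FreeAlgebra ℚ (Fin n)) :
    hausdorffDerivative x (glRep n g f) =
      ∑ j, (g : Matrix (Fin n) (Fin n) ℚ) x j • glRep n g (hausdorffDerivative j f) := by
  induction f using FreeAlgebra.induction with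
  | grade0 r =>
    rw [glRep_algebraMap]
    simp [Algebra.algebraMap_eq_smul_one, hausdorffDerivative_one]
  | grade1 y =>
    have h1 : glRep n g 1 = 1 := by simpa using glRep_algebraMap g 1
    have h2 : ∀ j, glRep n g (hausdorffDerivative j (FreeAlgebra.ι ℚ y)) =
        if y = j then 1 else 0 := by
      intro j
      rw [hausdorffDerivative_ι]
      split_ifs <;> simp [h1]
    simp only [h2, glRep_ι]
    simp [hausdorffDerivative_ι]
  | mul a b ha hb =>
    simp only [glRep_mul, hausdorffDerivative_mul, map_add, ha, hb, smul_add,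
      Finset.sum_add_distrib, Finset.sum_mul, Finset.mul_sum, smul_mul_assoc, mul_smul_comm]
  | add a b ha hb =>
    simp only [map_add, ha, hb, smul_add, Finset.sum_add_distrib]

/-- `𝒜'_n = ⋂ ker ∂_x`, the enveloping algebra of the derived free Lie algebra realized inside
`ℚ⟨x₁, …, x_n⟩`, with its action of `GL_n(ℚ)`. -/
def derivedEnveloping (n : ℕ) : Subrepresentation (glRep n) where
  toSubmodule := ⨅ x : Fin n, LinearMap.ker (hausdorffDerivative x)
  apply_mem_toSubmodule g f hf := by
    simp only [Submodule.mem_iInf, LinearMap.mem_ker] at hf ⊢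
    intro x
    simp [hausdorffDerivative_glRep, hf]

/-- The homogeneous noncommutative polynomials of degree `k`: the span of all products of `k`
variables. -/
def homogeneousPart (n k : ℕ) : Subrepresentation (glRep n) where
  toSubmodule := (Submodule.span ℚ (Set.range (FreeAlgebra.ι ℚ : Fin n → _))) ^ k
  apply_mem_toSubmodule g f hf := by
    have h1 : Submodule.map (substHom (g : Matrix (Fin n) (Fin n) ℚ)).toLinearMap
        (Submodule.span ℚ (Set.range (FreeAlgebra.ι ℚ : Fin n → _))) ≤
        Submodule.span ℚ (Set.range (FreeAlgebra.ι ℚ : Fin n → _)) := by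
      rw [Submodule.map_span, Submodule.span_le]
      rintro _ ⟨_, ⟨j, rfl⟩, rfl⟩
      simp only [AlgHom.toLinearMap_apply, substHom_ι]
      exact Submodule.sum_mem _ fun i _ =>
        Submodule.smul_mem _ _ (Submodule.subset_span ⟨i, rfl⟩)
    have h2 := Submodule.mem_map_of_mem
      (f := (substHom (g : Matrix (Fin n) (Fin n) ℚ)).toLinearMap) hf
    rw [Submodule.map_pow] at h2
    exact pow_le_pow_left' h1 k h2

/-- The homogeneous component of degree `k` of `𝒜'_n`. -/
def derivedEnvelopingPart (n k : ℕ) : Subrepresentation (glRep n) :=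
  derivedEnveloping n ⊓ homogeneousPart n k

instance (n k : ℕ) : FiniteDimensional ℚ (derivedEnvelopingPart n k).toSubmodule := by
  have h : (homogeneousPart n k).toSubmodule.FG :=
    Submodule.FG.pow (Submodule.fg_span (Set.finite_range _)) k
  have : FiniteDimensional ℚ (homogeneousPart n k).toSubmodule := Module.Finite.iff_fg.mpr h
  exact Submodule.finiteDimensional_of_le
    (inf_le_right : (derivedEnveloping n).toSubmodule ⊓ (homogeneousPart n k).toSubmodule ≤ _)

/-- The diagonal matrix `diag(a₁, …, a_n)` as an element of `GL_n(ℚ)`. -/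
def diagGL {n : ℕ} (a : Fin n → ℚˣ) : GL (Fin n) ℚ where
  val := Matrix.diagonal fun i => (a i : ℚ)
  inv := Matrix.diagonal fun i => ((a i)⁻¹ : ℚˣ)
  val_inv := by simp [Matrix.diagonal_mul_diagonal]
  inv_val := by simp [Matrix.diagonal_mul_diagonal]

/-- `χ` is the `GL_n(ℚ)`-character of `𝒜'_n`: the sum over all degrees `k` of the polynomials in
`a₁, …, a_n` giving the trace of `diag(a₁, …, a_n)` on the homogeneous component of degree `k`. -/
def IsCharacterDerivedEnveloping (n : ℕ) (χ : MvPowerSeries (Fin n) ℚ) : Prop :=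
  ∃ p : ℕ → MvPolynomial (Fin n) ℚ,
    (∀ (k : ℕ) (a : Fin n → ℚˣ),
      (derivedEnvelopingPart n k).toRepresentation.character (diagGL a) =
        MvPolynomial.eval (fun i => (a i : ℚ)) (p k)) ∧
    HasSum (fun k => (p k : MvPowerSeries (Fin n) ℚ)) χ

/-! ### Symmetric polynomials -/

/-- The elementary symmetric polynomial `e_{(i, 1^{k-i})}(a₁, …, a_n)`, for `i ≤ k`. -/
def elementaryHook (n k i : ℕ) : MvPolynomial (Fin n) ℚ :=
  MvPolynomial.esymmPart (Fin n) ℚ (Nat.Partition.ofMultiset (i ::ₘ Multiset.replicate (k - i) 1))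

/-- The alternant `det (a_i ^ {f_j})`. -/
def alternant {n : ℕ} (f : Fin n → ℕ) : MvPolynomial (Fin n) ℚ :=
  (Matrix.of fun i j : Fin n => (MvPolynomial.X i : MvPolynomial (Fin n) ℚ) ^ f j).det

/-- The staircase `δ = (n-1, n-2, …, 0)`. -/
def staircase (n : ℕ) (j : Fin n) : ℕ := n - 1 - j

theorem vandermonde_dvd_alternant {n : ℕ} (f : Fin n → ℕ) :
    (Matrix.vandermonde (MvPolynomial.X : Fin n → MvPolynomial (Fin n) ℚ)).det ∣ alternant f := by
  let P : Polynomial (MvPolynomial (Fin n) ℚ) :=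
    ∏ l : Fin n, (Polynomial.X - Polynomial.C (MvPolynomial.X l))
  have hP : P.Monic := Polynomial.monic_prod_X_sub_C _ _
  have hdeg : P.natDegree = n := by
    simp [P]
  let C : Matrix (Fin n) (Fin n) (MvPolynomial (Fin n) ℚ) :=
    Matrix.of fun k j => ((Polynomial.X ^ f j : Polynomial (MvPolynomial (Fin n) ℚ)) %ₘ P).coeff k
  have hM : (Matrix.of fun i j : Fin n => (MvPolynomial.X i : MvPolynomial (Fin n) ℚ) ^ f j) =
      Matrix.vandermonde (MvPolynomial.X : Fin n → MvPolynomial (Fin n) ℚ) * C := by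
    ext1 i j
    have hroot : P.eval (MvPolynomial.X i) = 0 := by
      simp only [P, Polynomial.eval_prod]
      exact Finset.prod_eq_zero (Finset.mem_univ i) (by simp)
    have hlt : ((Polynomial.X ^ f j : Polynomial (MvPolynomial (Fin n) ℚ)) %ₘ P).natDegree < n := by
      have h := Polynomial.natDegree_modByMonic_lt
        (Polynomial.X ^ f j : Polynomial (MvPolynomial (Fin n) ℚ)) hP (by
          intro h1
          have := i.pos
          rw [h1, Polynomial.natDegree_one] at hdeg
          omega)
      rwa [hdeg] at h
    have h1 : ((Polynomial.X ^ f j : Polynomial (MvPolynomial (Fin n) ℚ)) %ₘ P).eval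
        (MvPolynomial.X i) = MvPolynomial.X i ^ f j := by
      have h := congrArg (Polynomial.eval (MvPolynomial.X i))
        (Polynomial.modByMonic_add_div (Polynomial.X ^ f j) P)
      simpa [hroot] using h
    rw [Polynomial.eval_eq_sum_range' hlt, ← Fin.sum_univ_eq_sum_range
      (fun k => ((Polynomial.X ^ f j : Polynomial (MvPolynomial (Fin n) ℚ)) %ₘ P).coeff k *
        MvPolynomial.X i ^ k)] at h1
    simp only [Matrix.of_apply, Matrix.mul_apply, Matrix.vandermonde_apply, C, ← h1]
    exact Finset.sum_congr rfl fun k _ => mul_comm _ _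
  rw [alternant, hM, Matrix.det_mul]
  exact dvd_mul_right _ _

theorem alternant_staircase_dvd {n : ℕ} (f : Fin n → ℕ) :
    alternant (staircase n) ∣ alternant f := by
  have h : alternant (staircase n) =
      (Equiv.Perm.sign (Fin.revPerm : Equiv.Perm (Fin n)) : MvPolynomial (Fin n) ℚ) *
        (Matrix.vandermonde (MvPolynomial.X : Fin n → MvPolynomial (Fin n) ℚ)).det := by
    rw [← Matrix.det_permute', alternant]
    congr 1
    ext1 i j
    simp only [Matrix.of_apply, Matrix.submatrix_apply, Matrix.vandermonde_apply, staircase, id,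
      Fin.revPerm_apply, Fin.val_rev]
    congr 1
    omega
  rw [h]
  refine (IsUnit.mul_left_dvd ?_).mpr (vandermonde_dvd_alternant f)
  rcases Int.units_eq_one_or (Equiv.Perm.sign (Fin.revPerm : Equiv.Perm (Fin n))) with h | h <;>
    simp [h]

/-- The Schur polynomial `s_μ(a₁, …, a_n)`: the quotient `a_{μ+δ} / a_δ` of alternants if `μ` has
at most `n` rows, and `0` otherwise. -/
def schurPoly (n : ℕ) (μ : YoungDiagram) : MvPolynomial (Fin n) ℚ :=
  if μ.colLen 0 ≤ n then
    (alternant_staircase_dvd fun j : Fin n => μ.rowLen j + staircase n j).choose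
  else 0

theorem alternant_staircase_mul_schurPoly {n : ℕ} {μ : YoungDiagram} (h : μ.colLen 0 ≤ n) :
    alternant (staircase n) * schurPoly n μ =
      alternant fun j : Fin n => μ.rowLen j + staircase n j := by
  rw [schurPoly, if_pos h]
  exact (alternant_staircase_dvd fun j : Fin n => μ.rowLen j + staircase n j).choose_spec.symm

theorem alternant_staircase_ne_zero (n : ℕ) : alternant (staircase n) ≠ 0 := by
  intro h0
  have h : (Matrix.vandermonde (MvPolynomial.X : Fin n → MvPolynomial (Fin n) ℚ)).det = 0 := by
    have h := alternant_staircase_dvd (fun j : Fin n => (j : ℕ))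
    rw [h0, zero_dvd_iff] at h
    exact h
  exact Matrix.det_vandermonde_ne_zero_iff.mpr (MvPolynomial.X_injective) h

/-! ### Standard tableaux -/

/-- A standard Young tableau of shape `μ`: the cells of `μ` are filled bijectively with
`1, …, |μ|`, increasing along rows and columns. Entries outside `μ` are set to `0`. -/
structure StandardTableau (μ : YoungDiagram) where
  entry : ℕ → ℕ → ℕ
  row_strict : ∀ {i j₁ j₂ : ℕ}, j₁ < j₂ → (i, j₂) ∈ μ → entry i j₁ < entry i j₂
  col_strict : ∀ {i₁ i₂ j : ℕ}, i₁ < i₂ → (i₂, j) ∈ μ → entry i₁ j < entry i₂ j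
  bijOn : Set.BijOn (fun c : ℕ × ℕ => entry c.1 c.2) (μ.cells : Set (ℕ × ℕ)) (Set.Icc 1 μ.card)
  zeros : ∀ {i j : ℕ}, (i, j) ∉ μ → entry i j = 0

/-- The smallest positive integer which does not appear in the first column of `T`. -/
def StandardTableau.firstMissing {μ : YoungDiagram} (T : StandardTableau μ) : ℕ :=
  sInf {m : ℕ | 1 ≤ m ∧ ∀ i : ℕ, (i, 0) ∈ μ → T.entry i 0 ≠ m}

end NCHarm

end

noncomputable section

namespace NCHarm

variable {n : ℕ}

/-! ### Traces along split exact sequences -/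

/-! The product formula comes from imposing the conditions ∂_x f = 0 one variable at a time. Let
V(S, k) be the degree k polynomials killed by ∂_y for all y in S, and let x ∉ S. The derivatives
commute, so ∂_x maps V(S, k+1) to V(S, k), with kernel V(S ∪ {x}, k+1). It is onto: the alternating
Taylor sum ∑ (-1)^j/(j+1)! · (∂_x^j f) x^{j+1} is an explicit preimage of f, again killed by the
∂_y. Since diag(a) commutes with ∂_x up to the factor a_x, traces satisfy t(S ∪ {x}, k+1) = t(S,
k+1) - a_x t(S, k) (`constantsTrace_insert_succ`). Each variable thus multiplies the generating
series by 1 - a_x, and for S = ∅ the words form an eigenbasis, with series 1/(1 - e_1).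

The other two expansions rest on one remark (`hasSum_of_recurrence`): if c_0 = 1 and c_{k+1} = e_1
c_k + (-1)^{k+1} e_{k+1}, then (1 - e_1) ∑ c_k = ∑ (-1)^k e_k = ∏ (1 - a_i). The alternating sums of
the e_{(i,1^{k-i})} satisfy this recurrence at sight.

For tableaux, adding the entry k+1 in all possible ways to a tableau T with k cells multiplies its
Schur polynomial by e_1 (Pieri). The first missing entry does not change unless it equals k+1, which
forces T to be the column 1, …, k; even then it changes, to k+2, only when the new cell extends that
column. So parity is preserved except for the column with k+1 cells, which is gained if k+1 is even
and lost if k+1 is odd. Its Schur polynomial is e_{k+1}, hence the correction (-1)^{k+1} e_{k+1}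
(`oddTableauSum_succ`). -/

theorem trace_eq_add_of_split {R M N K : Type*} [Field R] [AddCommGroup M] [Module R M]
    [AddCommGroup N] [Module R N] [AddCommGroup K] [Module R K] [FiniteDimensional R M]
    [FiniteDimensional R N] [FiniteDimensional R K] (i : K →ₗ[R] M) (r : M →ₗ[R] K)
    (f : M →ₗ[R] N) (s : N →ₗ[R] M) (hri : r ∘ₗ i = LinearMap.id) (hfs : f ∘ₗ s = LinearMap.id)
    (hid : i ∘ₗ r + s ∘ₗ f = LinearMap.id) (φ : M →ₗ[R] M) (ψ : N →ₗ[R] N) (κ : K →ₗ[R] K)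
    (hψ : f ∘ₗ φ = ψ ∘ₗ f) (hκ : φ ∘ₗ i = i ∘ₗ κ) :
    LinearMap.trace R M φ = LinearMap.trace R K κ + LinearMap.trace R N ψ := by
  -- Insert the decomposition of the identity after φ. Cyclicity of the trace then turns φ i r into
  -- r φ i = κ and φ s f into f φ s = ψ.
  have h1 : φ = (φ ∘ₗ i) ∘ₗ r + (φ ∘ₗ s) ∘ₗ f := by
    rw [LinearMap.comp_assoc, LinearMap.comp_assoc, ← LinearMap.comp_add, hid, LinearMap.comp_id]
  rw [h1, map_add, LinearMap.trace_comp_comm' r (φ ∘ₗ i), hκ, LinearMap.trace_comp_comm' f (φ ∘ₗ s),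
    ← LinearMap.comp_assoc, hri, LinearMap.id_comp, ← LinearMap.comp_assoc, hψ,
    LinearMap.comp_assoc, hfs, LinearMap.comp_id]

/-! ### Words -/

theorem wordMonomial_cons (y : Fin n) (w : List (Fin n)) :
    wordMonomial (y :: w) = FreeAlgebra.ι ℚ y * wordMonomial w := by
  simp [wordMonomial]

theorem homogeneousPart_eq_span_words (n k : ℕ) :
    (homogeneousPart n k).toSubmodule =
      Submodule.span ℚ (Set.range fun w : Fin k → Fin n => wordMonomial (List.ofFn w)) := by
  change (Submodule.span ℚ (Set.range (FreeAlgebra.ι ℚ : Fin n → _))) ^ k = _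
  induction k with
  | zero =>
    rw [pow_zero, Submodule.one_eq_span]
    congr 1
    simp [wordMonomial]
  | succ k ih =>
    rw [pow_succ', ih, Submodule.span_mul_span]
    congr 1
    ext f
    simp only [Set.mem_mul, Set.mem_range]
    constructor
    · rintro ⟨_, ⟨y, rfl⟩, _, ⟨w, rfl⟩, rfl⟩
      exact ⟨Fin.cons y w, by simp [wordMonomial_cons]⟩
    · rintro ⟨w, rfl⟩
      exact ⟨_, ⟨w 0, rfl⟩, _, ⟨fun j => w j.succ, rfl⟩, by
        rw [← wordMonomial_cons, List.ofFn_succ]⟩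

theorem linearIndependent_words (n k : ℕ) :
    LinearIndependent ℚ fun w : Fin k → Fin n => wordMonomial (List.ofFn w) := by
  have h := (FreeAlgebra.basisFreeMonoid ℚ (Fin n)).linearIndependent.comp
    (fun w : Fin k → Fin n => FreeMonoid.ofList (List.ofFn w)) (fun v w h =>
      List.ofFn_injective (FreeMonoid.ofList.injective h))
  have e : (fun w : Fin k → Fin n => wordMonomial (List.ofFn w)) =
      FreeAlgebra.basisFreeMonoid ℚ (Fin n) ∘ fun w => FreeMonoid.ofList (List.ofFn w) := by
    funext w
    rw [Function.comp_apply, basisFreeMonoid_eq_wordMonomial, FreeMonoid.toList_ofList]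
  rw [e]
  exact h

theorem glRep_diagGL_ι (a : Fin n → ℚˣ) (j : Fin n) :
    glRep n (diagGL a) (FreeAlgebra.ι ℚ j) = (a j : ℚ) • FreeAlgebra.ι ℚ j := by
  rw [glRep_ι, Finset.sum_eq_single j]
  · simp [diagGL]
  · intro i _ hij
    simp [diagGL, hij]
  · simp

theorem glRep_diagGL_wordMonomial (a : Fin n → ℚˣ) (w : List (Fin n)) :
    glRep n (diagGL a) (wordMonomial w) = (w.map fun i => (a i : ℚ)).prod • wordMonomial w := by
  induction w with
  | nil => simpa [wordMonomial] using glRep_algebraMap (diagGL a) 1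
  | cons y w ih =>
    rw [wordMonomial_cons, glRep_mul, ih, glRep_diagGL_ι, List.map_cons, List.prod_cons,
      smul_mul_smul_comm]

theorem hausdorffDerivative_diagGL (a : Fin n → ℚˣ) (x : Fin n) (f : FreeAlgebra ℚ (Fin n)) :
    hausdorffDerivative x (glRep n (diagGL a) f) =
      (a x : ℚ) • glRep n (diagGL a) (hausdorffDerivative x f) := by
  rw [hausdorffDerivative_glRep, Finset.sum_eq_single x]
  · simp [diagGL]
  · intro i _ hij
    simp [diagGL, hij.symm]
  · simp

/-- This is what lets ∂_x act on the common kernel of the other derivatives. -/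
theorem hausdorffDerivative_comm (x y : Fin n) (f : FreeAlgebra ℚ (Fin n)) :
    hausdorffDerivative x (hausdorffDerivative y f) =
      hausdorffDerivative y (hausdorffDerivative x f) := by
  have key : hausdorffDerivative x ∘ₗ hausdorffDerivative y =
      hausdorffDerivative y ∘ₗ hausdorffDerivative x := by
    apply linearMap_ext_wordMonomial
    intro w
    simp only [LinearMap.comp_apply]
    induction w with
    | nil => simp [wordMonomial, hausdorffDerivative_one]
    | cons z w ih =>
      simp only [wordMonomial_cons, hausdorffDerivative_ι_mul, map_add, ih]
      split_ifs <;> (try rw [map_zero]) <;> (try rw [map_zero]) <;> abel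
  exact LinearMap.congr_fun key f

theorem homogeneousPart_one_mul {k : ℕ} (y : Fin n) {f : FreeAlgebra ℚ (Fin n)}
    (hf : f ∈ (homogeneousPart n k).toSubmodule) :
    FreeAlgebra.ι ℚ y * f ∈ (homogeneousPart n (k + 1)).toSubmodule := by
  change _ ∈ (Submodule.span ℚ (Set.range (FreeAlgebra.ι ℚ : Fin n → _))) ^ (k + 1)
  rw [pow_succ']
  exact Submodule.mul_mem_mul (Submodule.subset_span ⟨y, rfl⟩) hf

theorem homogeneousPart_mul_pow {k : ℕ} (y : Fin n) (j : ℕ) {f : FreeAlgebra ℚ (Fin n)}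
    (hf : f ∈ (homogeneousPart n k).toSubmodule) :
    f * FreeAlgebra.ι ℚ y ^ j ∈ (homogeneousPart n (k + j)).toSubmodule := by
  change _ ∈ (Submodule.span ℚ (Set.range (FreeAlgebra.ι ℚ : Fin n → _))) ^ (k + j)
  rw [pow_add]
  exact Submodule.mul_mem_mul hf
    (Submodule.pow_mem_pow _ (Submodule.subset_span (Set.mem_range_self y)) _)

theorem hausdorffDerivative_homogeneousPart_zero (x : Fin n) {f : FreeAlgebra ℚ (Fin n)}
    (hf : f ∈ (homogeneousPart n 0).toSubmodule) : hausdorffDerivative x f = 0 := by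
  change f ∈ (Submodule.span ℚ (Set.range (FreeAlgebra.ι ℚ : Fin n → _))) ^ 0 at hf
  rw [pow_zero, Submodule.one_eq_span, Submodule.mem_span_singleton] at hf
  obtain ⟨c, rfl⟩ := hf
  simp [hausdorffDerivative_one]

theorem hausdorffDerivative_mem_homogeneousPart (x : Fin n) {k : ℕ} {f : FreeAlgebra ℚ (Fin n)}
    (hf : f ∈ (homogeneousPart n (k + 1)).toSubmodule) :
    hausdorffDerivative x f ∈ (homogeneousPart n k).toSubmodule := by
  have key : ∀ w : List (Fin n), w.length = k + 1 →
      hausdorffDerivative x (wordMonomial w) ∈ (homogeneousPart n k).toSubmodule := by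
    clear hf
    induction k with
    | zero =>
      intro w hw
      obtain ⟨y, rfl⟩ := List.length_eq_one_iff.mp hw
      rw [wordMonomial_cons, hausdorffDerivative_ι_mul]
      simp only [wordMonomial, List.map_nil, List.prod_nil, hausdorffDerivative_one, mul_zero,
        add_zero]
      change _ ∈ (Submodule.span ℚ (Set.range (FreeAlgebra.ι ℚ : Fin n → _))) ^ 0
      rw [pow_zero]
      split_ifs
      · exact Submodule.one_le.mp le_rfl
      · exact zero_mem _
    | succ k ih =>
      intro w hw
      obtain ⟨y, w, rfl⟩ := List.exists_cons_of_length_eq_add_one hw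
      have hw' : w.length = k + 1 := by simpa using hw
      rw [wordMonomial_cons, hausdorffDerivative_ι_mul]
      refine add_mem ?_ (homogeneousPart_one_mul _ (ih w hw'))
      · split_ifs
        · rw [homogeneousPart_eq_span_words]
          exact Submodule.subset_span ⟨fun i => w.get (i.cast hw'.symm), congrArg wordMonomial
            (List.ext_getElem (by simp [hw']) fun j _ _ => by rw [List.getElem_ofFn]; rfl)⟩
        · exact zero_mem _
  rw [homogeneousPart_eq_span_words] at hf
  have h : Submodule.span ℚ (Set.range fun w : Fin (k + 1) → Fin n => wordMonomial (List.ofFn w)) ≤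
      (homogeneousPart n k).toSubmodule.comap (hausdorffDerivative x) := by
    rw [Submodule.span_le]
    rintro _ ⟨w, rfl⟩
    exact key _ (by simp)
  exact h hf

theorem trace_homogeneousPart (k : ℕ) (a : Fin n → ℚˣ) :
    LinearMap.trace ℚ _ ((glRep n (diagGL a)).restrict
      ((homogeneousPart n k).apply_mem_toSubmodule (diagGL a))) = (∑ i, (a i : ℚ)) ^ k := by
  let b : Module.Basis (Fin k → Fin n) ℚ (homogeneousPart n k).toSubmodule :=
    (Module.Basis.span (linearIndependent_words n k)).map
      (LinearEquiv.ofEq _ _ (homogeneousPart_eq_span_words n k).symm)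
  have hb : ∀ w, ((b w : (homogeneousPart n k).toSubmodule) : FreeAlgebra ℚ (Fin n)) =
      wordMonomial (List.ofFn w) := by
    intro w
    simp [b, Module.Basis.span_apply]
  rw [LinearMap.trace_eq_matrix_trace ℚ b, Matrix.trace]
  have hd : ∀ w, (glRep n (diagGL a)).restrict
      ((homogeneousPart n k).apply_mem_toSubmodule (diagGL a)) (b w) =
      (∏ j, (a (w j) : ℚ)) • b w := by
    intro w
    apply Subtype.ext
    rw [LinearMap.coe_restrict_apply, hb, glRep_diagGL_wordMonomial, Submodule.coe_smul, hb]
    simp [List.map_ofFn, List.prod_ofFn]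
  simp only [Matrix.diag_apply, LinearMap.toMatrix_apply, hd, map_smul, Finsupp.smul_apply,
    Module.Basis.repr_self, Finsupp.single_eq_same, smul_eq_mul, mul_one]
  -- Expanding the k-th power of the sum gives one monomial for each word of length k, namely its
  -- eigenvalue.
  rw [← Fin.prod_const, Finset.prod_univ_sum, Fintype.piFinset_univ]

/-! ### Constants of a set of Hausdorff derivatives -/

/-- The homogeneous polynomials of degree `k` annihilated by `∂_x` for all `x ∈ S`. -/
def constantsPart (S : Finset (Fin n)) (k : ℕ) : Submodule ℚ (FreeAlgebra ℚ (Fin n)) :=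
  (⨅ x ∈ S, LinearMap.ker (hausdorffDerivative x)) ⊓ (homogeneousPart n k).toSubmodule

theorem mem_constantsPart {S : Finset (Fin n)} {k : ℕ} {f : FreeAlgebra ℚ (Fin n)} :
    f ∈ constantsPart S k ↔
      (∀ x ∈ S, hausdorffDerivative x f = 0) ∧ f ∈ (homogeneousPart n k).toSubmodule := by
  simp [constantsPart, Submodule.mem_inf, Submodule.mem_iInf]

instance (S : Finset (Fin n)) (k : ℕ) : FiniteDimensional ℚ (constantsPart S k) := by
  have h : (homogeneousPart n k).toSubmodule.FG :=
    Submodule.FG.pow (Submodule.fg_span (Set.finite_range _)) k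
  have : FiniteDimensional ℚ (homogeneousPart n k).toSubmodule := Module.Finite.iff_fg.mpr h
  exact Submodule.finiteDimensional_of_le (inf_le_right : constantsPart S k ≤ _)

theorem glRep_diagGL_mem_constantsPart (a : Fin n → ℚˣ) (S : Finset (Fin n)) (k : ℕ) :
    ∀ f ∈ constantsPart S k, glRep n (diagGL a) f ∈ constantsPart S k := by
  intro f hf
  rw [mem_constantsPart] at hf ⊢
  exact ⟨fun x hx => by rw [hausdorffDerivative_diagGL, hf.1 x hx, map_zero, smul_zero],
    (homogeneousPart n k).apply_mem_toSubmodule _ hf.2⟩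

/-- The trace of `diag(a₁, …, a_n)` on `constantsPart S k`. -/
def constantsTrace (a : Fin n → ℚˣ) (S : Finset (Fin n)) (k : ℕ) : ℚ :=
  LinearMap.trace ℚ _ ((glRep n (diagGL a)).restrict (glRep_diagGL_mem_constantsPart a S k))

/-- Transports a trace between submodules that are equal only propositionally. -/
theorem trace_restrict_congr {R M : Type*} [CommRing R] [AddCommGroup M] [Module R M]
    {p q : Submodule R M} (h : p = q) (φ : M →ₗ[R] M) (hp : ∀ f ∈ p, φ f ∈ p)
    (hq : ∀ f ∈ q, φ f ∈ q) :
    LinearMap.trace R p (φ.restrict hp) = LinearMap.trace R q (φ.restrict hq) := by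
  subst h
  rfl

theorem constantsTrace_empty (a : Fin n → ℚˣ) (k : ℕ) :
    constantsTrace a ∅ k = (∑ i, (a i : ℚ)) ^ k := by
  rw [← trace_homogeneousPart]
  exact trace_restrict_congr (by simp [constantsPart]) _ _ _

theorem constantsTrace_univ (a : Fin n → ℚˣ) (k : ℕ) :
    constantsTrace a Finset.univ k =
      (derivedEnvelopingPart n k).toRepresentation.character (diagGL a) :=
  trace_restrict_congr (by
    simp [constantsPart, derivedEnvelopingPart, derivedEnveloping]) _ _
    ((derivedEnvelopingPart n k).apply_mem_toSubmodule (diagGL a))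

theorem constantsTrace_insert_zero (a : Fin n → ℚˣ) (x : Fin n) (S : Finset (Fin n)) :
    constantsTrace a (insert x S) 0 = constantsTrace a S 0 := by
  refine trace_restrict_congr ?_ _ _ _
  ext f
  simp only [mem_constantsPart, Finset.forall_mem_insert]
  constructor
  · rintro ⟨⟨-, h⟩, h'⟩
    exact ⟨h, h'⟩
  · rintro ⟨h, h'⟩
    exact ⟨⟨hausdorffDerivative_homogeneousPart_zero x h', h⟩, h'⟩

/-! ### Surjectivity of ∂_x and the trace recurrence -/

theorem hausdorffDerivative_ι_pow (x y : Fin n) (j : ℕ) :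
    hausdorffDerivative x (FreeAlgebra.ι ℚ y ^ j) =
      if y = x then (j : ℚ) • FreeAlgebra.ι ℚ y ^ (j - 1) else 0 := by
  induction j with
  | zero => simp [hausdorffDerivative_one]
  | succ j ih =>
    rw [pow_succ', hausdorffDerivative_ι_mul, ih]
    split_ifs
    · rcases j with _ | j
      · simp
      · rw [mul_smul_comm, Nat.add_sub_cancel, Nat.add_sub_cancel, ← pow_succ']
        push_cast
        module
    · simp

theorem hausdorffDerivative_iterate_comm (x y : Fin n) (j : ℕ) (f : FreeAlgebra ℚ (Fin n)) :
    hausdorffDerivative y ((hausdorffDerivative x ^ j) f) =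
      (hausdorffDerivative x ^ j) (hausdorffDerivative y f) := by
  induction j with
  | zero => simp
  | succ j ih =>
    rw [pow_succ', Module.End.mul_apply, Module.End.mul_apply, hausdorffDerivative_comm, ih]

theorem hausdorffDerivative_iterate_mem (x : Fin n) (j : ℕ) {k : ℕ} {f : FreeAlgebra ℚ (Fin n)}
    (hf : f ∈ (homogeneousPart n (k + j)).toSubmodule) :
    (hausdorffDerivative x ^ j) f ∈ (homogeneousPart n k).toSubmodule := by
  induction j generalizing k with
  | zero => simpa using hf
  | succ j ih =>
    rw [pow_succ', Module.End.mul_apply]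
    exact hausdorffDerivative_mem_homogeneousPart x (ih (by rwa [add_assoc, add_comm 1]))

/-- A right inverse of `∂_x` on the homogeneous polynomials of degree `k`. -/
def antiderivative (x : Fin n) (k : ℕ) : FreeAlgebra ℚ (Fin n) →ₗ[ℚ] FreeAlgebra ℚ (Fin n) :=
  ∑ j ∈ Finset.range (k + 1), ((-1 : ℚ) ^ j / (j + 1).factorial) •
    (LinearMap.mulRight ℚ (FreeAlgebra.ι ℚ x ^ (j + 1)) ∘ₗ hausdorffDerivative x ^ j)

theorem antiderivative_apply (x : Fin n) (k : ℕ) (f : FreeAlgebra ℚ (Fin n)) :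
    antiderivative x k f = ∑ j ∈ Finset.range (k + 1), ((-1 : ℚ) ^ j / (j + 1).factorial) •
      ((hausdorffDerivative x ^ j) f * FreeAlgebra.ι ℚ x ^ (j + 1)) := by
  simp [antiderivative, LinearMap.sum_apply]

/-- By the Leibniz rule the derivative of the sum telescopes to F 0 - F (k+1), where F 0 = f, and F
(k+1) = 0 because ∂_x^k f has degree 0. -/
theorem hausdorffDerivative_antiderivative (x : Fin n) {k : ℕ} {f : FreeAlgebra ℚ (Fin n)}
    (hf : f ∈ (homogeneousPart n k).toSubmodule) :
    hausdorffDerivative x (antiderivative x k f) = f := by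
  have hz : (hausdorffDerivative x ^ (k + 1)) f = 0 := by
    rw [pow_succ', Module.End.mul_apply]
    exact hausdorffDerivative_homogeneousPart_zero x
      (hausdorffDerivative_iterate_mem x k (by rwa [zero_add]))
  let F : ℕ → FreeAlgebra ℚ (Fin n) := fun j =>
    ((-1 : ℚ) ^ j / j.factorial) • ((hausdorffDerivative x ^ j) f * FreeAlgebra.ι ℚ x ^ j)
  have h : ∀ j, hausdorffDerivative x (((-1 : ℚ) ^ j / (j + 1).factorial) •
      ((hausdorffDerivative x ^ j) f * FreeAlgebra.ι ℚ x ^ (j + 1))) = F j - F (j + 1) := by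
    intro j
    have hj : ((j : ℚ) + 1) ≠ 0 := by positivity
    have hf : (j.factorial : ℚ) ≠ 0 := by positivity
    rw [map_smul, hausdorffDerivative_mul, hausdorffDerivative_ι_pow, if_pos rfl,
      Nat.add_sub_cancel, ← Module.End.mul_apply, ← pow_succ', smul_add, mul_smul_comm, smul_smul]
    simp only [F, Nat.factorial_succ]
    push_cast
    rw [show (-1 : ℚ) ^ j / ((j + 1) * j.factorial) * (j + 1) = (-1) ^ j / j.factorial by
      field_simp, pow_succ (-1 : ℚ)]
    module
  rw [antiderivative_apply, map_sum, Finset.sum_congr rfl fun j _ => h j,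
    Finset.sum_range_sub']
  simp [F, hz]

/-- For y ≠ x, both ∂_x and right multiplication by powers of x commute with ∂_y; this is where x ∉
S enters. -/
theorem antiderivative_mem (x : Fin n) {S : Finset (Fin n)} (hx : x ∉ S) {k : ℕ}
    {f : FreeAlgebra ℚ (Fin n)} (hf : f ∈ constantsPart S k) :
    antiderivative x k f ∈ constantsPart S (k + 1) := by
  rw [mem_constantsPart] at hf ⊢
  rw [antiderivative_apply]
  constructor
  · intro y hy
    have hxy : x ≠ y := fun h => hx (h ▸ hy)
    rw [map_sum]
    refine Finset.sum_eq_zero fun j _ => ?_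
    rw [map_smul, hausdorffDerivative_mul, hausdorffDerivative_ι_pow, if_neg hxy,
      hausdorffDerivative_iterate_comm, hf.1 y hy]
    simp
  · refine sum_mem fun j hj => Submodule.smul_mem _ _ ?_
    have hjk : k = (k - j) + j := by
      have := Finset.mem_range.mp hj
      omega
    have h := homogeneousPart_mul_pow x (j + 1)
      (hausdorffDerivative_iterate_mem x j (k := k - j) (by rw [← hjk]; exact hf.2))
    rwa [← add_assoc, ← hjk] at h

theorem hausdorffDerivative_mem_constantsPart (x : Fin n) {S : Finset (Fin n)} {k : ℕ} :
    ∀ f ∈ constantsPart S (k + 1), hausdorffDerivative x f ∈ constantsPart S k := by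
  intro f hf
  rw [mem_constantsPart] at hf ⊢
  exact ⟨fun y hy => by rw [hausdorffDerivative_comm, hf.1 y hy, map_zero],
    hausdorffDerivative_mem_homogeneousPart x hf.2⟩

/-- The sequence 0 → K → M → N → 0 given by d is split by s, with retraction v - s (d v) onto K. The
map induced by D on the quotient N is c • D, because d intertwines D only up to c. -/
theorem trace_restrict_eq_add {R V : Type*} [Field R] [AddCommGroup V] [Module R V]
    {M N K : Submodule R V} [FiniteDimensional R M] [FiniteDimensional R N] [FiniteDimensional R K]
    (d s D : V →ₗ[R] V) (c : R) (hK : ∀ v, v ∈ K ↔ v ∈ M ∧ d v = 0) (hd : ∀ v ∈ M, d v ∈ N)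
    (hs : ∀ v ∈ N, s v ∈ M) (hds : ∀ v ∈ N, d (s v) = v) (hM : ∀ v ∈ M, D v ∈ M)
    (hN : ∀ v ∈ N, D v ∈ N) (hDK : ∀ v ∈ K, D v ∈ K) (hdD : ∀ v, d (D v) = c • D (d v)) :
    LinearMap.trace R M (D.restrict hM) =
      LinearMap.trace R K (D.restrict hDK) + c * LinearMap.trace R N (D.restrict hN) := by
  have hKM : K ≤ M := fun v hv => ((hK v).mp hv).1
  let r : M →ₗ[R] K := LinearMap.codRestrict K ((LinearMap.id - s ∘ₗ d) ∘ₗ M.subtype) (by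
    intro v
    simp only [LinearMap.comp_apply, LinearMap.sub_apply, LinearMap.id_apply,
      Submodule.subtype_apply]
    refine (hK _).mpr ⟨sub_mem v.2 (hs _ (hd _ v.2)), ?_⟩
    rw [map_sub, hds _ (hd _ v.2), sub_self])
  have key := trace_eq_add_of_split (Submodule.inclusion hKM) r (d.restrict hd) (s.restrict hs)
    ?_ ?_ ?_ (D.restrict hM) (c • D.restrict hN) (D.restrict hDK) ?_ ?_
  · rw [key, map_smul, smul_eq_mul]
  · ext v
    simp [r, ((hK v).mp v.2).2]
  · ext v
    simp [hds]
  · ext v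
    simp [r]
  · ext v
    simp [hdD]
  · ext v
    simp

theorem constantsTrace_insert_succ (a : Fin n → ℚˣ) {x : Fin n} {S : Finset (Fin n)} (hx : x ∉ S)
    (k : ℕ) : constantsTrace a (insert x S) (k + 1) =
      constantsTrace a S (k + 1) - a x * constantsTrace a S k := by
  refine eq_sub_of_add_eq (trace_restrict_eq_add (hausdorffDerivative x) (antiderivative x k) _
    (a x : ℚ) ?_ (hausdorffDerivative_mem_constantsPart x) (fun _ => antiderivative_mem x hx)
    (fun f hf => hausdorffDerivative_antiderivative x (mem_constantsPart.mp hf).2) _ _ _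
    (hausdorffDerivative_diagGL a x)).symm
  intro f
  simp only [mem_constantsPart, Finset.forall_mem_insert]
  tauto

/-! ### The graded pieces of the character -/

/-- The polynomial in `a₁, …, a_n` giving the trace of `diag(a₁, …, a_n)` on
`constantsPart S k`, where `S` is the set of letters of `l`. -/
def constantsPoly : List (Fin n) → ℕ → MvPolynomial (Fin n) ℚ
  | [], k => (∑ i, MvPolynomial.X i) ^ k
  | _ :: l, 0 => constantsPoly l 0
  | x :: l, k + 1 => constantsPoly l (k + 1) - MvPolynomial.X x * constantsPoly l k

/-- The trace recurrence applies only when a new letter is added to the set, hence `Nodup`. -/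
theorem eval_constantsPoly (a : Fin n → ℚˣ) (l : List (Fin n)) (hl : l.Nodup) (k : ℕ) :
    MvPolynomial.eval (fun i => (a i : ℚ)) (constantsPoly l k) = constantsTrace a l.toFinset k := by
  induction l generalizing k with
  | nil => simp [constantsPoly, constantsTrace_empty]
  | cons x l ih =>
    rw [List.nodup_cons] at hl
    rcases k with _ | k
    · rw [constantsPoly, List.toFinset_cons, constantsTrace_insert_zero, ih hl.2]
    · rw [constantsPoly, List.toFinset_cons, constantsTrace_insert_succ a (by simpa using hl.1),
        map_sub, map_mul, ih hl.2, ih hl.2, MvPolynomial.eval_X]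

theorem isHomogeneous_constantsPoly (l : List (Fin n)) (k : ℕ) :
    (constantsPoly l k).IsHomogeneous k := by
  induction l generalizing k with
  | nil =>
    simpa [constantsPoly] using (MvPolynomial.IsHomogeneous.sum Finset.univ
      (fun i : Fin n => (MvPolynomial.X i : MvPolynomial (Fin n) ℚ)) 1
      fun i _ => MvPolynomial.isHomogeneous_X _ _).pow k
  | cons x l ih =>
    rcases k with _ | k
    · exact ih 0
    · refine (ih (k + 1)).sub ?_
      rw [add_comm]
      exact (MvPolynomial.isHomogeneous_X _ _).mul (ih k)

/-! ### Sums of homogeneous polynomials as power series -/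

/-- Only the finitely many p i of degree |m| contribute to the coefficient of m, so convergence is
automatic and the sum can be computed coefficientwise. -/
theorem hasSum_toMvPowerSeries_iff {ι σ : Type*} [Finite σ] {p : ι → MvPolynomial σ ℚ}
    {d : ι → ℕ} (hp : ∀ i, (p i).IsHomogeneous (d i)) (hd : ∀ k, {i | d i = k}.Finite)
    {χ : MvPowerSeries σ ℚ} :
    HasSum (fun i => (p i : MvPowerSeries σ ℚ)) χ ↔
      ∀ m, MvPowerSeries.coeff m χ = ∑ i ∈ (hd m.degree).toFinset, (p i).coeff m := by
  rw [MvPowerSeries.WithPiTopology.hasSum_iff_hasSum_coeff]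
  refine forall_congr' fun m => ?_
  simp only [MvPolynomial.coeff_coe]
  have h : HasSum (fun i => (p i).coeff m) (∑ i ∈ (hd m.degree).toFinset, (p i).coeff m) :=
    hasSum_sum_of_ne_finset_zero fun i hi => (hp i).coeff_eq_zero fun h => hi (by simp [h])
  exact ⟨fun h' => h'.unique h, fun e => e ▸ h⟩

theorem summable_toMvPowerSeries {σ : Type*} [Finite σ] {p : ℕ → MvPolynomial σ ℚ}
    (hp : ∀ k, (p k).IsHomogeneous k) : Summable fun k => (p k : MvPowerSeries σ ℚ) :=
  ⟨(fun m => ∑ i ∈ (Set.finite_singleton m.degree).toFinset, (p i).coeff m : (σ →₀ ℕ) → ℚ),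
    (hasSum_toMvPowerSeries_iff hp Set.finite_singleton).mpr fun _ => rfl⟩

/-- Regroup a sum of homogeneous polynomials by degree. -/
theorem hasSum_toMvPowerSeries_of_fiber {ι σ : Type*} [Finite σ] {p : ι → MvPolynomial σ ℚ}
    {d : ι → ℕ} (hp : ∀ i, (p i).IsHomogeneous (d i)) (hd : ∀ k, {i | d i = k}.Finite)
    {χ : MvPowerSeries σ ℚ}
    (hχ : HasSum (fun k => ((∑ i ∈ (hd k).toFinset, p i : MvPolynomial σ ℚ) : MvPowerSeries σ ℚ))
      χ) :
    HasSum (fun i => (p i : MvPowerSeries σ ℚ)) χ := by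
  have h1 : ∀ k, (∑ i ∈ (hd k).toFinset, p i).IsHomogeneous k := fun k =>
    MvPolynomial.IsHomogeneous.sum _ _ _ fun i hi => by
      have : d i = k := by simpa using hi
      exact this ▸ hp i
  have hk : ∀ k : ℕ, {i | i = k}.Finite := Set.finite_singleton
  rw [hasSum_toMvPowerSeries_iff h1 hk] at hχ
  rw [hasSum_toMvPowerSeries_iff hp hd]
  intro m
  have e : (hk m.degree).toFinset = {m.degree} := by ext; simp
  rw [hχ, e, Finset.sum_singleton, MvPolynomial.coeff_sum]

theorem toMvPowerSeries_sub {σ R : Type*} [CommRing R] (p q : MvPolynomial σ R) :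
    ((p - q : MvPolynomial σ R) : MvPowerSeries σ R) = p - q :=
  map_sub MvPolynomial.coeToMvPowerSeries.ringHom p q

theorem one_sub_sum_mul_inv :
    (1 - ∑ i : Fin n, (MvPowerSeries.X i : MvPowerSeries (Fin n) ℚ)) *
      (1 - ∑ i : Fin n, MvPowerSeries.X i)⁻¹ = 1 := by
  -- The constant coefficient is 1, so the inverse is not the default value 0.
  apply MvPowerSeries.mul_inv_cancel
  simp

theorem eq_mul_inv_of_one_sub_sum_mul {A B : MvPowerSeries (Fin n) ℚ}
    (h : (1 - ∑ i : Fin n, MvPowerSeries.X i) * A = B) :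
    A = B * (1 - ∑ i : Fin n, MvPowerSeries.X i)⁻¹ := by
  rw [← h, mul_comm, ← mul_assoc, mul_comm (_⁻¹), one_sub_sum_mul_inv, one_mul]

theorem toMvPowerSeries_sum_X :
    ((∑ i : Fin n, MvPolynomial.X i : MvPolynomial (Fin n) ℚ) : MvPowerSeries (Fin n) ℚ) =
      ∑ i : Fin n, MvPowerSeries.X i := by
  rw [← MvPolynomial.coeToMvPowerSeries.ringHom_apply, map_sum]
  simp

theorem hasSum_constantsPoly (l : List (Fin n)) :
    HasSum (fun k => (constantsPoly l k : MvPowerSeries (Fin n) ℚ))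
      ((l.map fun i => 1 - MvPowerSeries.X i).prod * (1 - ∑ i : Fin n, MvPowerSeries.X i)⁻¹) := by
  induction l with
  | nil =>
    obtain ⟨H, hH⟩ := summable_toMvPowerSeries (isHomogeneous_constantsPoly (n := n) [])
    -- Shifting the degree by one is multiplication by ∑ X_i, so the sum H satisfies H - 1 = (∑ X_i)
    -- H.
    have h1 := (hasSum_nat_add_iff' 1).mpr hH
    have h2 := hH.mul_left (∑ i : Fin n, MvPowerSeries.X i)
    have h3 : (fun k => (constantsPoly ([] : List (Fin n)) (k + 1) : MvPowerSeries (Fin n) ℚ)) =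
        fun k => (∑ i : Fin n, MvPowerSeries.X i) *
          (constantsPoly ([] : List (Fin n)) k : MvPowerSeries (Fin n) ℚ) := by
      funext k
      simp only [constantsPoly, pow_succ', MvPolynomial.coe_mul, toMvPowerSeries_sum_X]
    rw [h3] at h1
    have h4 := h1.unique h2
    rw [Finset.sum_range_one, constantsPoly, pow_zero, MvPolynomial.coe_one] at h4
    convert hH using 1
    rw [List.map_nil, List.prod_nil]
    refine (eq_mul_inv_of_one_sub_sum_mul ?_).symm
    rw [sub_mul, one_mul, ← h4]
    ring
  | cons x l ih =>
    have h1 := ih.mul_left (MvPowerSeries.X x)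
    -- Sum the recurrence over degrees k+1; the degree 0 terms for l and x :: l agree and are
    -- restored in `h4`.
    have h2 := ((hasSum_nat_add_iff' 1).mpr ih).sub h1
    have h3 : (fun k => (constantsPoly (x :: l) (k + 1) : MvPowerSeries (Fin n) ℚ)) = fun k =>
        (constantsPoly l (k + 1) : MvPowerSeries (Fin n) ℚ) -
          MvPowerSeries.X x * (constantsPoly l k : MvPowerSeries (Fin n) ℚ) := by
      funext k
      rw [constantsPoly, toMvPowerSeries_sub, MvPolynomial.coe_mul, MvPolynomial.coe_X]
    rw [← h3] at h2
    have h4 := (hasSum_nat_add_iff (f := fun k =>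
      (constantsPoly (x :: l) k : MvPowerSeries (Fin n) ℚ)) 1).mp h2
    rw [Finset.sum_range_one, Finset.sum_range_one, constantsPoly] at h4
    have e : ∀ A B C : MvPowerSeries (Fin n) ℚ, A - C - B * A + C = (1 - B) * A :=
      fun A B C => by ring
    rw [e, ← mul_assoc] at h4
    rw [List.map_cons, List.prod_cons]
    exact h4

/-! ### Alternating sums of elementary symmetric polynomials -/

theorem esymm_eq_zero_of_lt {k : ℕ} (h : n < k) : MvPolynomial.esymm (Fin n) ℚ k = 0 := by
  rw [MvPolynomial.esymm, Finset.powersetCard_eq_empty.mpr (by simpa using h), Finset.sum_empty]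

theorem hasSum_esymm :
    HasSum (fun k => (-1 : MvPowerSeries (Fin n) ℚ) ^ k *
      (MvPolynomial.esymm (Fin n) ℚ k : MvPowerSeries (Fin n) ℚ))
      (∏ i : Fin n, (1 - MvPowerSeries.X i)) := by
  have h : ∏ i : Fin n, (1 - MvPowerSeries.X i : MvPowerSeries (Fin n) ℚ) =
      ∑ k ∈ Finset.range (n + 1), (-1 : MvPowerSeries (Fin n) ℚ) ^ k *
        (MvPolynomial.esymm (Fin n) ℚ k : MvPowerSeries (Fin n) ℚ) := by
    have h1 : ∀ i : Fin n, (1 - MvPowerSeries.X i : MvPowerSeries (Fin n) ℚ) =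
        -MvPowerSeries.X i + 1 := fun i => by ring
    simp only [h1]
    rw [Finset.prod_add_one, Finset.sum_powerset, Finset.card_univ, Fintype.card_fin]
    refine Finset.sum_congr rfl fun k _ => ?_
    rw [MvPolynomial.esymm, ← MvPolynomial.coeToMvPowerSeries.ringHom_apply, map_sum,
      Finset.mul_sum]
    refine Finset.sum_congr rfl fun S hS => ?_
    rw [Finset.prod_neg, (Finset.mem_powersetCard.mp hS).2, map_prod]
    simp
  rw [h]
  refine hasSum_sum_of_ne_finset_zero fun k hk => ?_
  rw [esymm_eq_zero_of_lt (by simpa using hk), MvPolynomial.coe_zero, mul_zero]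

theorem isHomogeneous_esymm (k : ℕ) : (MvPolynomial.esymm (Fin n) ℚ k).IsHomogeneous k := by
  refine MvPolynomial.IsHomogeneous.sum _ _ _ fun S hS => ?_
  rw [← (Finset.mem_powersetCard.mp hS).2, Finset.card_eq_sum_ones]
  exact MvPolynomial.IsHomogeneous.prod _ _ _ fun i _ => MvPolynomial.isHomogeneous_X _ _

theorem isHomogeneous_of_recurrence {c : ℕ → MvPolynomial (Fin n) ℚ} (h0 : c 0 = 1)
    (hc : ∀ k, c (k + 1) = (∑ i, MvPolynomial.X i) * c k +
      (-1) ^ (k + 1) * MvPolynomial.esymm (Fin n) ℚ (k + 1)) (k : ℕ) : (c k).IsHomogeneous k := by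
  induction k with
  | zero => rw [h0]; exact MvPolynomial.isHomogeneous_one _ _
  | succ k ih =>
    rw [hc]
    refine MvPolynomial.IsHomogeneous.add ?_ ?_
    · rw [add_comm]
      exact (MvPolynomial.IsHomogeneous.sum _ _ _ fun i _ =>
        MvPolynomial.isHomogeneous_X _ _).mul ih
    · have h := isHomogeneous_esymm (n := n) (k + 1)
      rcases neg_one_pow_eq_or (MvPolynomial (Fin n) ℚ) (k + 1) with e | e
      · rwa [e, one_mul]
      · rw [e, neg_one_mul]
        exact h.neg

/-- Summing the recurrence over k gives H - 1 = e_1 H + (∏ (1 - X_i) - 1), which is solved for H. -/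
theorem hasSum_of_recurrence {c : ℕ → MvPolynomial (Fin n) ℚ} (h0 : c 0 = 1)
    (hc : ∀ k, c (k + 1) = (∑ i, MvPolynomial.X i) * c k +
      (-1) ^ (k + 1) * MvPolynomial.esymm (Fin n) ℚ (k + 1)) :
    HasSum (fun k => (c k : MvPowerSeries (Fin n) ℚ))
      ((∏ i : Fin n, (1 - MvPowerSeries.X i)) * (1 - ∑ i : Fin n, MvPowerSeries.X i)⁻¹) := by
  obtain ⟨H, hH⟩ := summable_toMvPowerSeries (isHomogeneous_of_recurrence h0 hc)
  have h1 := (hasSum_nat_add_iff' 1).mpr hH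
  have h2 := (hH.mul_left (∑ i : Fin n, MvPowerSeries.X i)).add
    ((hasSum_nat_add_iff' 1).mpr (hasSum_esymm (n := n)))
  have h3 : (fun k => (c (k + 1) : MvPowerSeries (Fin n) ℚ)) = fun k =>
      (∑ i : Fin n, MvPowerSeries.X i) * (c k : MvPowerSeries (Fin n) ℚ) +
        (-1) ^ (k + 1) *
          (MvPolynomial.esymm (Fin n) ℚ (k + 1) : MvPowerSeries (Fin n) ℚ) := by
    funext k
    rw [hc, MvPolynomial.coe_add, MvPolynomial.coe_mul, MvPolynomial.coe_mul,
      toMvPowerSeries_sum_X, MvPolynomial.coe_pow]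
    congr 3
    rw [← MvPolynomial.coeToMvPowerSeries.ringHom_apply, map_neg, map_one]
  rw [h3] at h1
  have h4 := h1.unique h2
  simp only [Finset.sum_range_one, h0, MvPolynomial.coe_one, pow_zero, MvPolynomial.esymm_zero,
    one_mul] at h4
  convert hH using 1
  refine (eq_mul_inv_of_one_sub_sum_mul ?_).symm
  rw [sub_mul, one_mul]
  linear_combination h4

/-- `Nat.Partition.ofMultiset` discards zero parts; for i ≠ 0 there are none. -/
theorem elementaryHook_eq {k i : ℕ} (hi : i ≠ 0) :
    elementaryHook n k i =
      MvPolynomial.esymm (Fin n) ℚ i * (∑ j, MvPolynomial.X j) ^ (k - i) := by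
  rw [elementaryHook, MvPolynomial.esymmPart, Nat.Partition.ofMultiset_parts,
    Multiset.filter_eq_self.mpr]
  · rw [Multiset.map_cons, Multiset.prod_cons, Multiset.map_replicate, Multiset.prod_replicate,
      MvPolynomial.esymm_one]
  · intro x hx
    rcases Multiset.mem_cons.mp hx with rfl | hx
    · exact hi
    · rw [Multiset.eq_of_mem_replicate hx]
      exact one_ne_zero

/-- The degree `k` part of the character, as an alternating sum of `e_{(i, 1^{k-i})}`. -/
def alternatingHookSum (n k : ℕ) : MvPolynomial (Fin n) ℚ :=
  (if k = 0 then 1 else 0) + ∑ i ∈ Finset.Icc 2 k, (-1) ^ i * elementaryHook n k i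

theorem alternatingHookSum_zero : alternatingHookSum n 0 = 1 := by
  simp [alternatingHookSum]

theorem alternatingHookSum_succ (k : ℕ) :
    alternatingHookSum n (k + 1) = (∑ i, MvPolynomial.X i) * alternatingHookSum n k +
      (-1) ^ (k + 1) * MvPolynomial.esymm (Fin n) ℚ (k + 1) := by
  rcases k with _ | k
  -- In degree 1 the terms e_1 · 1 and -e_1 cancel, which is why the index i starts at 2.
  · simp [alternatingHookSum, MvPolynomial.esymm_one]
  · rw [alternatingHookSum, alternatingHookSum, if_neg (by omega), if_neg (by omega), zero_add,
      zero_add, ← Finset.insert_Icc_right_eq_Icc_add_one (by omega), Finset.sum_insert (by simp),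
      add_comm, Finset.mul_sum]
    congr 1
    · refine Finset.sum_congr rfl fun i hi => ?_
      have hi := Finset.mem_Icc.mp hi
      rw [elementaryHook_eq (by omega), elementaryHook_eq (by omega),
        show k + 1 + 1 - i = (k + 1 - i) + 1 by omega, pow_succ]
      ring
    · rw [elementaryHook_eq (by omega), Nat.sub_self, pow_zero, mul_one]

theorem hasSum_alternatingHookSum :
    HasSum (fun k => (alternatingHookSum n k : MvPowerSeries (Fin n) ℚ))
      ((∏ i : Fin n, (1 - MvPowerSeries.X i)) * (1 - ∑ i : Fin n, MvPowerSeries.X i)⁻¹) :=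
  hasSum_of_recurrence alternatingHookSum_zero alternatingHookSum_succ

theorem hasSum_elementaryHook :
    HasSum
      (fun k : ℕ => ∑ i ∈ Finset.Icc 2 k,
        (-1 : MvPowerSeries (Fin n) ℚ) ^ i *
          (elementaryHook n k i : MvPowerSeries (Fin n) ℚ))
      ((∏ i : Fin n, (1 - MvPowerSeries.X i)) * (1 - ∑ i : Fin n, MvPowerSeries.X i)⁻¹ - 1) := by
  have h := (hasSum_alternatingHookSum (n := n)).sub
    (hasSum_ite_eq 0 (1 : MvPowerSeries (Fin n) ℚ))
  refine h.congr_fun fun k => ?_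
  simp only [alternatingHookSum, ← MvPolynomial.coeToMvPowerSeries.ringHom_apply, map_add, map_sum,
    map_mul, map_pow, map_neg, map_one]
  split_ifs <;> simp

/-! ### The Pieri rule for alternants -/

theorem alternant_eq_zero {f : Fin n → ℕ} {i j : Fin n} (hij : i ≠ j) (h : f i = f j) :
    alternant f = 0 :=
  Matrix.det_zero_of_column_eq hij fun k => by simp [h]

/-- Expand the determinant over permutations σ. As e_k is symmetric, its variables may be relabelled
by σ, and then each monomial indexed by S raises by one the exponents f j with j ∈ S. -/
theorem alternant_mul_esymm (f : Fin n → ℕ) (k : ℕ) :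
    alternant f * MvPolynomial.esymm (Fin n) ℚ k =
      ∑ S ∈ Finset.powersetCard k Finset.univ, alternant fun j => f j + if j ∈ S then 1 else 0 := by
  simp only [alternant, Matrix.det_apply, Matrix.of_apply]
  rw [Finset.sum_comm, Finset.sum_mul]
  refine Finset.sum_congr rfl fun σ _ => ?_
  rw [← Finset.smul_sum, smul_mul_assoc]
  congr 1
  have h : MvPolynomial.esymm (Fin n) ℚ k =
      ∑ S ∈ Finset.powersetCard k Finset.univ, ∏ j ∈ S, MvPolynomial.X (σ j) := by
    conv_lhs => rw [← MvPolynomial.esymm_isSymmetric (Fin n) ℚ k σ, MvPolynomial.esymm, map_sum]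
    simp only [map_prod, MvPolynomial.rename_X]
  rw [h, Finset.mul_sum]
  refine Finset.sum_congr rfl fun S _ => ?_
  simp only [pow_add, Finset.prod_mul_distrib, pow_ite, pow_one, pow_zero]
  rw [Finset.prod_ite_mem, Finset.univ_inter]

theorem alternant_mul_sum_X (f : Fin n → ℕ) :
    alternant f * ∑ i, MvPolynomial.X i =
      ∑ r, alternant fun j => f j + if j = r then 1 else 0 := by
  rw [← MvPolynomial.esymm_one, alternant_mul_esymm, Finset.powersetCard_one, Finset.sum_map]
  simp

theorem isHomogeneous_alternant (f : Fin n → ℕ) : (alternant f).IsHomogeneous (∑ j, f j) := by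
  rw [alternant, Matrix.det_apply]
  refine MvPolynomial.IsHomogeneous.sum _ _ _ fun σ _ => ?_
  have h : (∏ i, (Matrix.of fun i j : Fin n => (MvPolynomial.X i : MvPolynomial (Fin n) ℚ) ^ f j)
      (σ i) i).IsHomogeneous (∑ j, f j) :=
    MvPolynomial.IsHomogeneous.prod _ _ _ fun i _ => MvPolynomial.isHomogeneous_X_pow _ _
  rcases Int.units_eq_one_or (Equiv.Perm.sign σ) with e | e
  · rwa [e, one_smul]
  · rw [e, Units.neg_smul, one_smul]
    exact h.neg

theorem homogeneousComponent_mul {σ : Type*} {a : MvPolynomial σ ℚ} {k : ℕ}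
    (hk : a.IsHomogeneous k) (b : MvPolynomial σ ℚ) (d : ℕ) :
    MvPolynomial.homogeneousComponent (k + d) (a * b) =
      a * MvPolynomial.homogeneousComponent d b := by
  let _ : GradedRing (MvPolynomial.homogeneousSubmodule σ ℚ) := MvPolynomial.gradedAlgebra
  rw [← MvPolynomial.decomposition.decompose'_apply, ← MvPolynomial.decomposition.decompose'_apply]
  exact DirectSum.coe_decompose_mul_add_of_left_mem
    (MvPolynomial.homogeneousSubmodule σ ℚ) (i := k) (j := d) (a := a) (b := b) hk

/-- The component of degree k + d of a b is a times the degree d component of b. For d ≠ m it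
vanishes, and a can be cancelled. -/
theorem isHomogeneous_of_mul {σ : Type*} {a b : MvPolynomial σ ℚ} {k m : ℕ} (ha : a ≠ 0)
    (hk : a.IsHomogeneous k) (hab : (a * b).IsHomogeneous (k + m)) : b.IsHomogeneous m := by
  have h0 : ∀ d, d ≠ m → MvPolynomial.homogeneousComponent d b = 0 := by
    intro d hd
    have h1 := homogeneousComponent_mul hk b d
    rw [MvPolynomial.homogeneousComponent_of_mem hab, if_neg (by omega)] at h1
    exact (mul_eq_zero.mp h1.symm).resolve_left ha
  have hb := MvPolynomial.sum_homogeneousComponent b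
  rw [← hb]
  refine MvPolynomial.IsHomogeneous.sum _ _ _ fun d _ => ?_
  by_cases hd : d = m
  · subst hd
    exact MvPolynomial.homogeneousComponent_isHomogeneous _ _
  · rw [h0 d hd]
    exact MvPolynomial.isHomogeneous_zero _ _ _

/-! ### Rows of Young diagrams -/

theorem rowLen_eq_zero_iff {μ : YoungDiagram} {i : ℕ} : μ.rowLen i = 0 ↔ μ.colLen 0 ≤ i := by
  rw [← not_lt, ← YoungDiagram.mem_iff_lt_colLen, YoungDiagram.mem_iff_lt_rowLen, not_lt,
    nonpos_iff_eq_zero]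

theorem sum_rowLen {μ : YoungDiagram} (h : μ.colLen 0 ≤ n) :
    ∑ j : Fin n, μ.rowLen j = μ.card := by
  rw [Fin.sum_univ_eq_sum_range (fun j => μ.rowLen j) n, YoungDiagram.card,
    Finset.card_eq_sum_card_fiberwise (f := Prod.fst) (t := Finset.range n)]
  · refine Finset.sum_congr rfl fun i _ => ?_
    rw [YoungDiagram.rowLen_eq_card]
    rfl
  · rintro ⟨i, j⟩ hc
    have h1 : (i, 0) ∈ μ := μ.up_left_mem le_rfl (Nat.zero_le j) hc
    have h2 := YoungDiagram.mem_iff_lt_colLen.mp h1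
    simpa using h2.trans_le h

theorem isHomogeneous_schurPoly (n : ℕ) (μ : YoungDiagram) :
    (schurPoly n μ).IsHomogeneous μ.card := by
  by_cases h : μ.colLen 0 ≤ n
  · refine isHomogeneous_of_mul (alternant_staircase_ne_zero n) (isHomogeneous_alternant _) ?_
    rw [alternant_staircase_mul_schurPoly h, ← sum_rowLen h, add_comm, ← Finset.sum_add_distrib]
    exact isHomogeneous_alternant _
  · rw [schurPoly, if_neg h]
    exact MvPolynomial.isHomogeneous_zero _ _ _

/-- The rows to which a cell can be added. -/
def addableRows (μ : YoungDiagram) : Finset ℕ :=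
  (Finset.range (μ.colLen 0 + 1)).filter fun r => r = 0 ∨ μ.rowLen r < μ.rowLen (r - 1)

/-- The range in the definition only provides finiteness: a row strictly shorter than its
predecessor has a nonempty predecessor, so its index is at most the number of rows. -/
theorem mem_addableRows {μ : YoungDiagram} {r : ℕ} :
    r ∈ addableRows μ ↔ r = 0 ∨ μ.rowLen r < μ.rowLen (r - 1) := by
  rw [addableRows, Finset.mem_filter, and_iff_right_iff_imp, Finset.mem_range]
  rintro (rfl | h)
  · exact Nat.succ_pos _
  · by_contra h'
    have : μ.rowLen (r - 1) = 0 := rowLen_eq_zero_iff.mpr (by omega)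
    omega

theorem le_colLen_of_mem_addableRows {μ : YoungDiagram} {r : ℕ} (hr : r ∈ addableRows μ) :
    r ≤ μ.colLen 0 := by
  have := Finset.mem_range.mp (Finset.mem_filter.mp hr).1
  omega

theorem colLen_mem_addableRows (μ : YoungDiagram) : μ.colLen 0 ∈ addableRows μ := by
  rw [mem_addableRows, rowLen_eq_zero_iff.mpr le_rfl, pos_iff_ne_zero, ne_eq, rowLen_eq_zero_iff]
  omega

/-- The diagram `μ` with a cell added at the end of row `r`, if this is possible. -/
def addCell (μ : YoungDiagram) (r : ℕ) : YoungDiagram where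
  cells := if r ∈ addableRows μ then insert (r, μ.rowLen r) μ.cells else μ.cells
  isLowerSet := by
    split_ifs with h
    · rintro ⟨i₁, j₁⟩ ⟨i₂, j₂⟩ hle hc
      obtain ⟨hi, hj⟩ : i₂ ≤ i₁ ∧ j₂ ≤ j₁ := hle
      simp only [Finset.coe_insert, Set.mem_insert_iff, Finset.mem_coe, YoungDiagram.mem_cells,
        Prod.mk.injEq] at hc ⊢
      rcases hc with ⟨rfl, rfl⟩ | hc
      · rw [YoungDiagram.mem_iff_lt_rowLen]
        rcases hi.eq_or_lt with rfl | hi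
        · omega
        · right
          rw [mem_addableRows] at h
          have := μ.rowLen_anti i₂ (i₁ - 1) (by omega)
          omega
      · exact Or.inr (μ.up_left_mem hi hj hc)
    · exact μ.isLowerSet

theorem cells_addCell {μ : YoungDiagram} {r : ℕ} (h : r ∈ addableRows μ) :
    (addCell μ r).cells = insert (r, μ.rowLen r) μ.cells :=
  if_pos h

theorem mem_addCell {μ : YoungDiagram} {r : ℕ} (h : r ∈ addableRows μ) {c : ℕ × ℕ} :
    c ∈ addCell μ r ↔ c = (r, μ.rowLen r) ∨ c ∈ μ := by
  rw [← YoungDiagram.mem_cells, cells_addCell h, Finset.mem_insert, YoungDiagram.mem_cells]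

theorem rowLen_addCell {μ : YoungDiagram} {r : ℕ} (h : r ∈ addableRows μ) (i : ℕ) :
    (addCell μ r).rowLen i = μ.rowLen i + if i = r then 1 else 0 := by
  refine eq_of_forall_lt_iff fun j => ?_
  rw [← YoungDiagram.mem_iff_lt_rowLen, mem_addCell h, YoungDiagram.mem_iff_lt_rowLen,
    Prod.mk.injEq]
  split_ifs with hi
  · subst hi
    omega
  · simp [hi]

theorem card_addCell {μ : YoungDiagram} {r : ℕ} (h : r ∈ addableRows μ) :
    (addCell μ r).card = μ.card + 1 := by
  rw [YoungDiagram.card, cells_addCell h, Finset.card_insert_of_notMem]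
  rw [YoungDiagram.mem_cells, YoungDiagram.mem_iff_lt_rowLen]
  exact lt_irrefl _

theorem colLen_le_addCell {μ : YoungDiagram} {r : ℕ} (h : r ∈ addableRows μ) :
    μ.colLen 0 ≤ (addCell μ r).colLen 0 := by
  rw [← rowLen_eq_zero_iff]
  have h1 : (addCell μ r).rowLen ((addCell μ r).colLen 0) = 0 := rowLen_eq_zero_iff.mpr le_rfl
  rw [rowLen_addCell h] at h1
  omega

theorem lt_colLen_addCell {μ : YoungDiagram} {r : ℕ} (h : r ∈ addableRows μ) :
    r < (addCell μ r).colLen 0 := by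
  rw [← not_le, ← rowLen_eq_zero_iff, rowLen_addCell h, if_pos rfl]
  omega

theorem colLen_addCell_le {μ : YoungDiagram} {r m : ℕ} (h : r ∈ addableRows μ) (hr : r < m)
    (hm : μ.colLen 0 ≤ m) : (addCell μ r).colLen 0 ≤ m := by
  rw [← rowLen_eq_zero_iff, rowLen_addCell h, if_neg hr.ne', add_zero, rowLen_eq_zero_iff]
  exact hm

/-- The Pieri rule for multiplication by `e₁`. -/
theorem schurPoly_mul_sum_X (n : ℕ) (μ : YoungDiagram) :
    schurPoly n μ * ∑ i, MvPolynomial.X i = ∑ r ∈ addableRows μ, schurPoly n (addCell μ r) := by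
  by_cases h : μ.colLen 0 ≤ n
  swap
  · rw [schurPoly, if_neg h, zero_mul, Finset.sum_eq_zero]
    intro r hr
    rw [schurPoly, if_neg fun h' => h ((colLen_le_addCell hr).trans h')]
  apply mul_left_cancel₀ (alternant_staircase_ne_zero n)
  rw [← mul_assoc, alternant_staircase_mul_schurPoly h, alternant_mul_sum_X, Finset.mul_sum]
  let F : ℕ → MvPolynomial (Fin n) ℚ := fun r =>
    if r ∈ addableRows μ then alternant (staircase n) * schurPoly n (addCell μ r) else 0
  have h1 : ∀ r : Fin n, (alternant fun j : Fin n =>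
      μ.rowLen j + staircase n j + if j = r then 1 else 0) = F r := by
    intro r
    by_cases hr : (r : ℕ) ∈ addableRows μ
    · simp only [F]
      rw [if_pos hr, alternant_staircase_mul_schurPoly (colLen_addCell_le hr r.2 h)]
      congr 1
      funext j
      simp only [rowLen_addCell hr, Fin.ext_iff]
      omega
    · simp only [F]
      rw [if_neg hr]
      rw [mem_addableRows, not_or, not_lt] at hr
      have hr2 := r.2
      -- If row r is not addable, rows r - 1 and r have equal length; lengthening row r makes the
      -- two shifted exponents coincide.
      refine alternant_eq_zero (i := r) (j := ⟨r - 1, by omega⟩) ?_ ?_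
      · rw [ne_eq, Fin.ext_iff]
        simp only
        omega
      · have := μ.rowLen_anti (r - 1) r (by omega)
        simp only [if_true, Fin.ext_iff, staircase]
        rw [if_neg (by omega)]
        omega
  rw [Finset.sum_congr rfl fun r _ => h1 r, Fin.sum_univ_eq_sum_range F n]
  have h2 : ∀ r ∈ addableRows μ, alternant (staircase n) * schurPoly n (addCell μ r) = F r :=
    fun r hr => by simp only [F, if_pos hr]
  rw [Finset.sum_congr rfl h2]
  -- Adding a cell in a row r ≥ n gives more than n rows and Schur polynomial 0. So summing over r <
  -- n and over addable rows gives the same result.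
  have h3 : ∀ r, n ≤ r → F r = 0 := by
    intro r hr
    by_cases hr' : r ∈ addableRows μ
    · simp only [F]
      rw [if_pos hr', schurPoly, if_neg, mul_zero]
      have := lt_colLen_addCell hr'
      omega
    · simp only [F, if_neg hr']
  refine (Finset.sum_subset (Finset.subset_union_left (s₂ := addableRows μ))
    fun r _ hr => h3 r (by simpa using hr)).trans
    (Finset.sum_subset (Finset.subset_union_right (s₁ := Finset.range n)) fun r _ hr => ?_).symm
  simp only [F, if_neg hr]

theorem eq_filter_lt_of_forall_pred_mem {S : Finset (Fin n)}
    (hS : ∀ i j : Fin n, (j : ℕ) = i + 1 → j ∈ S → i ∈ S) :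
    S = Finset.univ.filter fun j : Fin n => (j : ℕ) < S.card := by
  have hle : ∀ d : ℕ, ∀ i j : Fin n, (j : ℕ) = i + d → j ∈ S → i ∈ S := by
    intro d
    induction d with
    | zero =>
      intro i j hij hj
      rwa [show i = j from Fin.ext (by omega)]
    | succ d ih =>
      intro i j hij hj
      have := j.2
      exact ih i ⟨i + d, by omega⟩ rfl (hS _ j (by simp only; omega) hj)
  refine Finset.eq_of_subset_of_card_le ?_ ?_
  · intro j hj
    rw [Finset.mem_filter]
    refine ⟨Finset.mem_univ _, ?_⟩
    have h1 : Finset.Iic j ⊆ S := fun i hi => by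
      have : (i : ℕ) ≤ j := Fin.le_def.mp (Finset.mem_Iic.mp hi)
      exact hle (j - i) i j (by omega) hj
    have h2 := Finset.card_le_card h1
    rw [Fin.card_Iic] at h2
    omega
  · rw [Fin.card_filter_val_lt]
    exact min_le_right _ _

/-- The Schur polynomial of a column is an elementary symmetric polynomial. -/
theorem schurPoly_column (n : ℕ) {μ : YoungDiagram} {k : ℕ}
    (hμ : ∀ i, μ.rowLen i = if i < k then 1 else 0) :
    schurPoly n μ = MvPolynomial.esymm (Fin n) ℚ k := by
  have hcol : μ.colLen 0 = k := by
    refine eq_of_forall_ge_iff fun i => ?_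
    rw [← rowLen_eq_zero_iff, hμ]
    split_ifs <;> simp <;> omega
  by_cases h : k ≤ n
  swap
  · rw [schurPoly, if_neg (by rwa [hcol]), esymm_eq_zero_of_lt (not_le.mp h)]
  apply mul_left_cancel₀ (alternant_staircase_ne_zero n)
  rw [alternant_staircase_mul_schurPoly (by rwa [hcol]), alternant_mul_esymm,
    Finset.sum_eq_single (Finset.univ.filter fun j : Fin n => (j : ℕ) < k)]
  · congr 1
    funext j
    simp [hμ, add_comm]
  -- A set S that is not an initial segment contains some j whose predecessor i is not in S. The
  -- staircase drops by one from i to j, so the exponents at i and j become equal and the alternant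
  -- vanishes.
  · intro S hS hne
    have hcard := (Finset.mem_powersetCard.mp hS).2
    have : ¬ ∀ i j : Fin n, (j : ℕ) = i + 1 → j ∈ S → i ∈ S := fun h' =>
      hne (by rw [← hcard]; exact eq_filter_lt_of_forall_pred_mem h')
    push Not at this
    obtain ⟨i, j, hij, hj, hi⟩ := this
    refine alternant_eq_zero (i := i) (j := j) (fun e => hi (e ▸ hj)) ?_
    have := j.2
    rw [if_neg hi, if_pos hj, staircase, staircase]
    omega
  · intro h'
    refine absurd (Finset.mem_powersetCard.mpr ⟨Finset.subset_univ _, ?_⟩) h'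
    rw [Fin.card_filter_val_lt, min_eq_right h]

/-! ### Adding a cell to a standard tableau -/

namespace StandardTableau

variable {μ : YoungDiagram} (T : StandardTableau μ)

theorem entry_mem_Icc {i j : ℕ} (h : (i, j) ∈ μ) : T.entry i j ∈ Set.Icc 1 μ.card :=
  T.bijOn.mapsTo h

theorem entry_ne_zero_iff {i j : ℕ} : T.entry i j ≠ 0 ↔ (i, j) ∈ μ := by
  refine ⟨fun h => by_contra fun h' => h (T.zeros h'), fun h => ?_⟩
  have := (T.entry_mem_Icc h).1
  omega

theorem entry_le (i j : ℕ) : T.entry i j ≤ μ.card := by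
  by_cases h : (i, j) ∈ μ
  · exact (T.entry_mem_Icc h).2
  · rw [T.zeros h]
    exact Nat.zero_le _

/-- The shape is the support of the entries, since these are positive on cells and 0 elsewhere. This
avoids comparing tableaux across different shape types. -/
theorem sigma_ext {T U : Σ μ, StandardTableau μ}
    (h : ∀ i j, T.2.entry i j = U.2.entry i j) : T = U := by
  obtain ⟨μ, T⟩ := T
  obtain ⟨ν, U⟩ := U
  have e : μ = ν := by
    ext ⟨i, j⟩
    rw [YoungDiagram.mem_cells, YoungDiagram.mem_cells, ← T.entry_ne_zero_iff,
      ← U.entry_ne_zero_iff, h]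
  subst e
  obtain ⟨t, _, _, _, _⟩ := T
  obtain ⟨u, _, _, _, _⟩ := U
  obtain rfl : t = u := funext fun i => funext fun j => h i j
  rfl

/-- Add a cell with the largest entry at the end of row `r`. -/
def add {r : ℕ} (hr : r ∈ addableRows μ) : StandardTableau (addCell μ r) where
  entry i j := if (i, j) = (r, μ.rowLen r) then μ.card + 1 else T.entry i j
  row_strict {i j₁ j₂} hlt hmem := by
    rw [mem_addCell hr] at hmem
    rcases hmem with e | hmem
    · rw [if_pos e, if_neg]
      · exact Nat.lt_succ_of_le (T.entry_le _ _)
      · simp only [Prod.mk.injEq] at e ⊢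
        omega
    · have h1 := YoungDiagram.mem_iff_lt_rowLen.mp hmem
      rw [if_neg, if_neg]
      · exact T.row_strict hlt hmem
      · rintro ⟨⟩
        omega
      · rintro ⟨⟩
        omega
  col_strict {i₁ i₂ j} hlt hmem := by
    rw [mem_addCell hr] at hmem
    rcases hmem with e | hmem
    · rw [if_pos e, if_neg]
      · exact Nat.lt_succ_of_le (T.entry_le _ _)
      · simp only [Prod.mk.injEq] at e ⊢
        omega
    · have h1 := YoungDiagram.mem_iff_lt_rowLen.mp (μ.up_left_mem hlt.le le_rfl hmem)
      have h2 := YoungDiagram.mem_iff_lt_rowLen.mp hmem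
      rw [if_neg, if_neg]
      · exact T.col_strict hlt hmem
      · rintro ⟨⟩
        omega
      · rintro ⟨⟩
        omega
  bijOn := by
    have hnot : (r, μ.rowLen r) ∉ μ := by
      rw [YoungDiagram.mem_iff_lt_rowLen]
      exact lt_irrefl _
    have h1 : Set.BijOn (fun c : ℕ × ℕ => if (c.1, c.2) = (r, μ.rowLen r) then μ.card + 1
        else T.entry c.1 c.2) (μ.cells : Set (ℕ × ℕ)) (Set.Icc 1 μ.card) := by
      refine T.bijOn.congr fun c hc => ?_
      rw [if_neg]
      intro e
      exact hnot (e ▸ hc)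
    have h2 := h1.insert (a := (r, μ.rowLen r)) (by simp)
    rw [cells_addCell hr, card_addCell hr, Finset.coe_insert]
    convert h2 using 1
    ext m
    simp only [Set.mem_Icc, Set.mem_insert_iff, if_true]
    omega
  zeros {i j} hmem := by
    rw [mem_addCell hr, not_or] at hmem
    rw [if_neg hmem.1, T.zeros hmem.2]

theorem add_entry {r : ℕ} (hr : r ∈ addableRows μ) (i j : ℕ) :
    (T.add hr).entry i j = if (i, j) = (r, μ.rowLen r) then μ.card + 1 else T.entry i j :=
  rfl

theorem add_entry_eq_iff {r : ℕ} (hr : r ∈ addableRows μ) (i j : ℕ) :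
    (T.add hr).entry i j = μ.card + 1 ↔ (i, j) = (r, μ.rowLen r) := by
  rw [add_entry]
  split_ifs with h
  · simp [h]
  · have := T.entry_le i j
    simp only [h, iff_false]
    omega

/-- Every nonempty tableau arises by adding a cell with the largest entry. -/
theorem exists_eq_add {ν : YoungDiagram} (U : StandardTableau ν) {k : ℕ} (hk : ν.card = k + 1) :
    ∃ (μ : YoungDiagram) (T : StandardTableau μ) (r : ℕ) (hr : r ∈ addableRows μ),
      μ.card = k ∧ (⟨addCell μ r, T.add hr⟩ : Σ μ, StandardTableau μ) = ⟨ν, U⟩ := by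
  obtain ⟨⟨r, s⟩, hc, he⟩ := U.bijOn.surjOn (show k + 1 ∈ Set.Icc 1 ν.card by simp [hk])
  simp only at he
  replace hc : (r, s) ∈ ν := hc
  -- The cell with the maximal entry is a corner: a cell to its right or below it would carry a
  -- larger entry.
  have hright : ∀ j, s < j → (r, j) ∉ ν := fun j hj h => by
    have h1 := U.row_strict hj h
    have h2 := U.entry_le r j
    omega
  have hdown : ∀ i, r < i → (i, s) ∉ ν := fun i hi h => by
    have h1 := U.col_strict hi h
    have h2 := U.entry_le i s
    omega
  let μ : YoungDiagram :=
    { cells := ν.cells.erase (r, s)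
      isLowerSet := by
        rintro ⟨i₁, j₁⟩ ⟨i₂, j₂⟩ hle hmem
        obtain ⟨hi, hj⟩ : i₂ ≤ i₁ ∧ j₂ ≤ j₁ := hle
        simp only [Finset.coe_erase, Set.mem_sdiff, Finset.mem_coe, YoungDiagram.mem_cells,
          Set.mem_singleton_iff] at hmem ⊢
        refine ⟨ν.up_left_mem hi hj hmem.1, ?_⟩
        rintro ⟨⟩
        rcases hi.eq_or_lt with rfl | hi
        · rcases hj.eq_or_lt with rfl | hj
          · exact hmem.2 rfl
          · exact hright _ hj hmem.1
        · exact hdown _ hi (ν.up_left_mem le_rfl hj hmem.1) }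
  have hμ : ∀ c, c ∈ μ ↔ c ≠ (r, s) ∧ c ∈ ν := fun c => Finset.mem_erase
  have hrow : μ.rowLen r = s := by
    refine eq_of_forall_lt_iff fun j => ?_
    rw [← YoungDiagram.mem_iff_lt_rowLen, hμ]
    constructor
    · rintro ⟨h1, h2⟩
      by_contra h
      rcases (not_lt.mp h).eq_or_lt with rfl | h
      · exact h1 rfl
      · exact hright j h h2
    · intro h
      refine ⟨?_, ν.up_left_mem le_rfl h.le hc⟩
      rintro ⟨⟩
      exact lt_irrefl _ h
  have hcard : μ.card = k := by
    change (ν.cells.erase (r, s)).card = k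
    rw [Finset.card_erase_of_mem hc]
    change ν.card - 1 = k
    omega
  have hr : r ∈ addableRows μ := by
    rw [mem_addableRows, hrow, ← YoungDiagram.mem_iff_lt_rowLen, hμ, or_iff_not_imp_left]
    intro h0
    refine ⟨?_, ν.up_left_mem (Nat.sub_le _ _) le_rfl hc⟩
    rw [ne_eq, Prod.mk.injEq]
    omega
  let T : StandardTableau μ :=
    { entry := fun i j => if (i, j) = (r, s) then 0 else U.entry i j
      row_strict := by
        intro i j₁ j₂ hlt hmem
        have h1 := (hμ _).mp (μ.up_left_mem le_rfl hlt.le hmem)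
        rw [hμ] at hmem
        rw [if_neg h1.1, if_neg hmem.1]
        exact U.row_strict hlt hmem.2
      col_strict := by
        intro i₁ i₂ j hlt hmem
        have h1 := (hμ _).mp (μ.up_left_mem hlt.le le_rfl hmem)
        rw [hμ] at hmem
        rw [if_neg h1.1, if_neg hmem.1]
        exact U.col_strict hlt hmem.2
      bijOn := by
        have h1 := U.bijOn.sdiff_singleton (a := (r, s)) hc
        have h2 : (ν.cells : Set (ℕ × ℕ)) \ {(r, s)} = μ.cells := by
          ext c
          change _ ↔ c ∈ μ
          rw [hμ]
          simp [and_comm]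
        have h3 : Set.Icc 1 ν.card \ {U.entry r s} = Set.Icc 1 μ.card := by
          ext m
          simp only [Set.mem_sdiff, Set.mem_Icc, Set.mem_singleton_iff]
          omega
        rw [h2, h3] at h1
        refine h1.congr fun c h => ?_
        have h4 := ((hμ c).mp h).1
        change _ = if c = (r, s) then _ else _
        rw [if_neg h4]
      zeros := by
        intro i j hmem
        rw [hμ, not_and, ne_eq] at hmem
        split_ifs with h
        · rfl
        · exact U.zeros (hmem h) }
  refine ⟨μ, T, r, hr, hcard, sigma_ext fun i j => ?_⟩
  change (T.add hr).entry i j = U.entry i j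
  rw [add_entry, hrow]
  split_ifs with h
  · obtain ⟨rfl, rfl⟩ := Prod.mk.inj h
    rw [hcard, he]
  · change (if (i, j) = (r, s) then 0 else U.entry i j) = _
    rw [if_neg h]

/-! ### The first missing entry of the first column -/

theorem card_add_one_mem_missing :
    μ.card + 1 ∈ {m : ℕ | 1 ≤ m ∧ ∀ i : ℕ, (i, 0) ∈ μ → T.entry i 0 ≠ m} :=
  ⟨Nat.succ_pos _, fun i _ h => by
    have := T.entry_le i 0
    omega⟩

theorem firstMissing_le_of_missing {m : ℕ} (hm : 1 ≤ m)
    (h : ∀ i : ℕ, (i, 0) ∈ μ → T.entry i 0 ≠ m) : T.firstMissing ≤ m :=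
  Nat.sInf_le ⟨hm, h⟩

theorem firstMissing_le : T.firstMissing ≤ μ.card + 1 :=
  Nat.sInf_le T.card_add_one_mem_missing

theorem one_le_firstMissing : 1 ≤ T.firstMissing :=
  (Nat.sInf_mem ⟨_, T.card_add_one_mem_missing⟩).1

theorem entry_ne_firstMissing (i : ℕ) : T.entry i 0 ≠ T.firstMissing := by
  by_cases h : (i, 0) ∈ μ
  · exact (Nat.sInf_mem ⟨_, T.card_add_one_mem_missing⟩).2 i h
  · rw [T.zeros h]
    have := T.one_le_firstMissing
    omega

theorem exists_entry_eq_of_lt_firstMissing {m : ℕ} (hm : 1 ≤ m) (h : m < T.firstMissing) :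
    ∃ i, T.entry i 0 = m := by
  by_contra! h'
  exact not_le.mpr h (T.firstMissing_le_of_missing hm fun i _ => h' i)

theorem firstMissing_eq_of {m : ℕ} (hm : ∀ i, T.entry i 0 ≠ m) (hm1 : 1 ≤ m)
    (h : ∀ l, 1 ≤ l → l < m → ∃ i, T.entry i 0 = l) : T.firstMissing = m := by
  refine le_antisymm (T.firstMissing_le_of_missing hm1 fun i _ => hm i) (not_lt.mp fun hlt => ?_)
  obtain ⟨i, hi⟩ := h _ T.one_le_firstMissing hlt
  exact T.entry_ne_firstMissing i hi

variable {r : ℕ} (hr : r ∈ addableRows μ)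

theorem exists_add_entry_eq {m : ℕ} (hm : 1 ≤ m) (h : m < T.firstMissing) :
    ∃ i, (T.add hr).entry i 0 = m := by
  obtain ⟨i, hi⟩ := T.exists_entry_eq_of_lt_firstMissing hm h
  refine ⟨i, ?_⟩
  rw [add_entry, if_neg, hi]
  intro e
  have h1 : (i, 0) ∈ μ := T.entry_ne_zero_iff.mp (by omega)
  rw [e, YoungDiagram.mem_iff_lt_rowLen] at h1
  exact lt_irrefl _ h1

theorem firstMissing_add_of_le (h : T.firstMissing ≤ μ.card) :
    (T.add hr).firstMissing = T.firstMissing := by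
  refine firstMissing_eq_of _ (fun i => ?_) T.one_le_firstMissing
    fun l hl hlt => T.exists_add_entry_eq hr hl hlt
  rw [add_entry]
  split_ifs
  · omega
  · exact T.entry_ne_firstMissing i

/-- An addable row other than the one below the diagram is nonempty, so the new entry lies outside
the first column and |μ| + 1 is still missing there. -/
theorem firstMissing_add_of_ne (h : T.firstMissing = μ.card + 1) (hne : r ≠ μ.colLen 0) :
    (T.add hr).firstMissing = μ.card + 1 := by
  refine firstMissing_eq_of _ (fun i hi => ?_) (Nat.succ_pos _)
    fun l hl hlt => T.exists_add_entry_eq hr hl (by omega)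
  rw [add_entry_eq_iff, Prod.mk.injEq, eq_comm (a := 0), rowLen_eq_zero_iff] at hi
  have := le_colLen_of_mem_addableRows hr
  omega

/-- The first column already contains 1, …, |μ|, and the new cell puts |μ| + 1 in it. -/
theorem firstMissing_add_of_eq (h : T.firstMissing = μ.card + 1) (he : r = μ.colLen 0) :
    (T.add hr).firstMissing = μ.card + 2 := by
  refine firstMissing_eq_of _ (fun i hi => ?_) (Nat.succ_pos _) fun l hl hlt => ?_
  · have := (T.add hr).entry_le i 0
    rw [card_addCell hr] at this
    omega
  · rcases (show l ≤ μ.card + 1 by omega).eq_or_lt with rfl | hlt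
    · refine ⟨r, (T.add_entry_eq_iff hr r 0).mpr ?_⟩
      rw [rowLen_eq_zero_iff.mpr he.ge]
    · exact T.exists_add_entry_eq hr hl (by omega)

end StandardTableau

/-! ### Sums over standard tableaux -/

/-- Standard tableaux with `k` cells. -/
abbrev TableauOfCard (k : ℕ) : Type :=
  {T : Σ μ : YoungDiagram, StandardTableau μ // T.1.card = k}

/-- A tableau with `k + 1` cells is a tableau with `k` cells and a row to which a cell is added. -/
def addTableau (k : ℕ) (p : Σ T : TableauOfCard k, addableRows T.1.1) : TableauOfCard (k + 1) :=
  ⟨⟨addCell p.1.1.1 p.2, p.1.1.2.add p.2.2⟩, by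
    rw [card_addCell p.2.2, p.1.2]⟩

/-- The position of the largest entry recovers the row, and erasing that entry recovers the smaller
tableau. -/
theorem addTableau_bijective (k : ℕ) : Function.Bijective (addTableau k) := by
  constructor
  · rintro ⟨⟨⟨μ, T⟩, hT⟩, ⟨r, hr⟩⟩ ⟨⟨⟨ν, U⟩, hU⟩, ⟨s, hs⟩⟩ h
    simp only at hT hU hr hs
    have h0 : (⟨addCell μ r, T.add hr⟩ : Σ μ, StandardTableau μ) = ⟨addCell ν s, U.add hs⟩ :=
      congrArg Subtype.val h
    have h1 : ∀ i j, (T.add hr).entry i j = (U.add hs).entry i j := by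
      have h2 := congrArg (fun V : Σ μ, StandardTableau μ => V.2.entry) h0
      exact fun i j => congrFun (congrFun h2 i) j
    have hc : (r, μ.rowLen r) = (s, ν.rowLen s) := by
      rw [← U.add_entry_eq_iff hs, ← h1, hU, ← hT, T.add_entry_eq_iff hr]
    have hTU : (⟨μ, T⟩ : Σ μ, StandardTableau μ) = ⟨ν, U⟩ := by
      refine StandardTableau.sigma_ext fun i j => ?_
      have h2 := h1 i j
      rw [StandardTableau.add_entry, StandardTableau.add_entry, ← hc] at h2
      change T.entry i j = U.entry i j
      split_ifs at h2 with h3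
      · obtain ⟨rfl, rfl⟩ := Prod.mk.inj h3
        rw [T.zeros (by simp [YoungDiagram.mem_iff_lt_rowLen]), U.zeros]
        rw [hc]
        simp [YoungDiagram.mem_iff_lt_rowLen]
      · exact h2
    cases hTU
    obtain rfl := (Prod.mk.inj hc).1
    rfl
  · rintro ⟨⟨ν, U⟩, hU⟩
    obtain ⟨μ, T, r, hr, hk, h⟩ := U.exists_eq_add hU
    exact ⟨⟨⟨⟨μ, T⟩, hk⟩, ⟨r, hr⟩⟩, Subtype.ext h⟩

theorem entry_eq_zero_of_card_eq_zero (T : TableauOfCard 0) (i j : ℕ) : T.1.2.entry i j = 0 := by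
  have := T.1.2.entry_le i j
  have := T.2
  omega

/-- The tableau without cells. -/
def emptyTableau : TableauOfCard 0 :=
  ⟨⟨⊥, {
    entry := fun _ _ => 0
    row_strict := fun _ h => absurd h (YoungDiagram.notMem_bot _)
    col_strict := fun _ h => absurd h (YoungDiagram.notMem_bot _)
    bijOn := by simp [YoungDiagram.card]
    zeros := fun _ => rfl }⟩, rfl⟩

instance : Unique (TableauOfCard 0) where
  default := emptyTableau
  uniq T := Subtype.ext (StandardTableau.sigma_ext fun i j => by
    rw [entry_eq_zero_of_card_eq_zero, entry_eq_zero_of_card_eq_zero])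

instance (k : ℕ) : Finite (TableauOfCard k) := by
  induction k with
  | zero => infer_instance
  | succ k ih => exact Finite.of_surjective _ (addTableau_bijective k).2

instance (k : ℕ) : Fintype (TableauOfCard k) := Fintype.ofFinite _

theorem sum_tableauOfCard_succ {M : Type*} [AddCommMonoid M] (k : ℕ)
    (F : TableauOfCard (k + 1) → M) :
    ∑ U, F U = ∑ T : TableauOfCard k, ∑ r : addableRows T.1.1, F (addTableau k ⟨T, r⟩) := by
  rw [← Fintype.sum_sigma', ← (addTableau_bijective k).sum_comp]

/-- The tableau consisting of a single column is the only one with `k` cells whose first missing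
entry is `k + 1`. -/
theorem exists_unique_column (k : ℕ) : ∃ T₀ : TableauOfCard k,
    (∀ T : TableauOfCard k, T.1.2.firstMissing = k + 1 ↔ T = T₀) ∧
      ∀ i, T₀.1.1.rowLen i = if i < k then 1 else 0 := by
  induction k with
  | zero =>
    refine ⟨emptyTableau, fun T => ⟨fun _ => Subsingleton.elim _ _, fun _ => ?_⟩, fun i => ?_⟩
    · have h1 := T.1.2.firstMissing_le
      have h2 := T.1.2.one_le_firstMissing
      have h3 := T.2
      omega
    · rw [if_neg (Nat.not_lt_zero i)]
      refine eq_of_forall_lt_iff fun j => ?_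
      rw [← YoungDiagram.mem_iff_lt_rowLen]
      exact iff_of_false (YoungDiagram.notMem_bot _) (Nat.not_lt_zero j)
  | succ k ih =>
    obtain ⟨T₀, hT₀, hrow⟩ := ih
    have hcol : T₀.1.1.colLen 0 = k := by
      refine eq_of_forall_ge_iff fun i => ?_
      rw [← rowLen_eq_zero_iff, hrow]
      split_ifs <;> simp <;> omega
    refine ⟨addTableau k ⟨T₀, ⟨_, colLen_mem_addableRows _⟩⟩, fun U => ⟨fun h => ?_, ?_⟩,
      fun i => ?_⟩
    · obtain ⟨⟨T, ⟨r, hr⟩⟩, rfl⟩ := (addTableau_bijective k).2 U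
      replace h : (T.1.2.add hr).firstMissing = k + 1 + 1 := h
      have hcard := T.2
      have hle := T.1.2.firstMissing_le
      -- A smaller first missing entry would survive the addition of the cell and could not become k
      -- + 2.
      have hT : T.1.2.firstMissing = k + 1 := by
        by_contra hne
        rw [T.1.2.firstMissing_add_of_le hr (by omega)] at h
        omega
      obtain rfl := (hT₀ T).mp hT
      obtain rfl : r = T.1.1.colLen 0 := by
        by_contra hne
        rw [T.1.2.firstMissing_add_of_ne hr (by omega) hne] at h
        omega
      rfl
    · rintro rfl
      have h1 := (hT₀ T₀).mpr rfl
      have h2 := T₀.2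
      have h3 := T₀.1.2.firstMissing_add_of_eq (colLen_mem_addableRows _) (by omega) rfl
      exact h3.trans (by omega)
    · have h1 := rowLen_addCell (colLen_mem_addableRows T₀.1.1) i
      refine h1.trans ?_
      rw [hrow, hcol]
      split_ifs <;> omega

open Classical in
/-- The sum of the Schur polynomials over the tableaux with `k` cells and odd first missing
entry. -/
def oddTableauSum (n k : ℕ) : MvPolynomial (Fin n) ℚ :=
  ∑ T : TableauOfCard k, if Odd T.1.2.firstMissing then schurPoly n T.1.1 else 0

theorem oddTableauSum_zero (n : ℕ) : oddTableauSum n 0 = 1 := by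
  have h1 : (default : TableauOfCard 0).1.2.firstMissing = 1 := by
    have h1 := (default : TableauOfCard 0).1.2.firstMissing_le
    have h2 := (default : TableauOfCard 0).1.2.one_le_firstMissing
    have h3 := (default : TableauOfCard 0).2
    omega
  rw [oddTableauSum, Fintype.sum_unique, if_pos (by rw [h1]; exact odd_one),
    schurPoly_column n (k := 0), MvPolynomial.esymm_zero]
  intro i
  rw [if_neg (Nat.not_lt_zero i)]
  refine eq_of_forall_lt_iff fun j => ?_
  rw [← YoungDiagram.mem_iff_lt_rowLen]
  exact iff_of_false (YoungDiagram.notMem_bot _) (Nat.not_lt_zero j)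

-- If the first missing entry is unaffected by every addition, this is the Pieri rule. Otherwise it
-- is k + 1, and the only addition altering its parity is the one below the first column, which
-- yields the signed correction.
open Classical in
theorem sum_add_odd (n k : ℕ) (T : TableauOfCard k) :
    (∑ r : addableRows T.1.1, if Odd (addTableau k ⟨T, r⟩).1.2.firstMissing then
        schurPoly n (addTableau k ⟨T, r⟩).1.1 else 0) =
      (∑ i, MvPolynomial.X i) * (if Odd T.1.2.firstMissing then schurPoly n T.1.1 else 0) +
        if T.1.2.firstMissing = k + 1 then
          (-1) ^ (k + 1) * schurPoly n (addCell T.1.1 (T.1.1.colLen 0)) else 0 := by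
  have hT := T.2
  have hle := T.1.2.firstMissing_le
  have hP := schurPoly_mul_sum_X n T.1.1
  rw [← Finset.sum_coe_sort (addableRows T.1.1), mul_comm] at hP
  change (∑ r : addableRows T.1.1, if Odd (T.1.2.add r.2).firstMissing then
        schurPoly n (addCell T.1.1 r) else 0) = _
  by_cases h : T.1.2.firstMissing = k + 1
  swap
  · rw [if_neg h, add_zero, mul_ite, hP, mul_zero]
    simp only [fun r : addableRows T.1.1 => T.1.2.firstMissing_add_of_le r.2 (by omega)]
    split_ifs
    · rfl
    · exact Finset.sum_const_zero
  rw [if_pos h, h]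
  let c : addableRows T.1.1 := ⟨_, colLen_mem_addableRows T.1.1⟩
  have hc : (T.1.2.add c.2).firstMissing = k + 2 := by
    rw [T.1.2.firstMissing_add_of_eq c.2 (by omega) rfl, hT]
  have hne : ∀ r ∈ Finset.univ.erase c, (T.1.2.add r.2).firstMissing = k + 1 := by
    intro r hr
    rw [T.1.2.firstMissing_add_of_ne r.2 (by omega), hT]
    intro e
    exact (Finset.mem_erase.mp hr).1 (Subtype.ext e)
  rw [← Finset.add_sum_erase _ _ (Finset.mem_univ c)] at hP ⊢
  rw [hc, Finset.sum_congr rfl fun r hr => by rw [hne r hr]]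
  -- For k + 1 even, T is not counted and only its extension at `c` is; for k + 1 odd, T is counted
  -- and exactly the extension at `c` is lost.
  rcases Nat.even_or_odd (k + 1) with hk | hk
  · rw [if_pos (by exact hk.add_one), if_neg (Nat.not_odd_iff_even.mpr hk),
      Finset.sum_congr rfl fun r _ => if_neg (Nat.not_odd_iff_even.mpr hk), hk.neg_one_pow,
      Finset.sum_const_zero]
    ring
  · rw [if_neg (Nat.not_odd_iff_even.mpr (by exact hk.add_one)), if_pos hk,
      Finset.sum_congr rfl fun r _ => if_pos hk, hk.neg_one_pow, hP]
    ring

theorem oddTableauSum_succ (n k : ℕ) :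
    oddTableauSum n (k + 1) = (∑ i, MvPolynomial.X i) * oddTableauSum n k +
      (-1) ^ (k + 1) * MvPolynomial.esymm (Fin n) ℚ (k + 1) := by
  obtain ⟨T₀, hT₀, hrow⟩ := exists_unique_column k
  have hcol : T₀.1.1.colLen 0 = k := by
    refine eq_of_forall_ge_iff fun i => ?_
    rw [← rowLen_eq_zero_iff, hrow]
    split_ifs <;> simp <;> omega
  rw [oddTableauSum, sum_tableauOfCard_succ, Finset.sum_congr rfl fun T _ => sum_add_odd n k T,
    Finset.sum_add_distrib, ← Finset.mul_sum, oddTableauSum]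
  congr 1
  rw [Finset.sum_eq_single T₀ (fun T _ hT => if_neg fun h => hT ((hT₀ T).mp h))
    (fun h => absurd (Finset.mem_univ _) h), if_pos ((hT₀ T₀).mpr rfl),
    schurPoly_column n (k := k + 1)]
  intro i
  rw [rowLen_addCell (colLen_mem_addableRows _), hrow, hcol]
  split_ifs <;> omega

/-- Standard tableaux whose first missing entry is odd. -/
abbrev OddTableau : Type :=
  {T : Σ μ : YoungDiagram, StandardTableau μ // Odd T.2.firstMissing}

theorem finite_oddTableau_card (k : ℕ) : {T : OddTableau | T.1.1.card = k}.Finite := by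
  refine Set.finite_coe_iff.mp (Finite.of_injective (β := TableauOfCard k)
    (fun T => ⟨T.1.1, T.2⟩) fun T U h => Subtype.ext (Subtype.ext ?_))
  exact congrArg (fun V : TableauOfCard k => V.1) h

theorem sum_oddTableau_card (n k : ℕ) :
    ∑ T ∈ (finite_oddTableau_card k).toFinset, schurPoly n T.1.1 = oddTableauSum n k := by
  rw [oddTableauSum, ← Finset.sum_filter]
  refine Finset.sum_bij (fun T hT => ⟨T.1, (finite_oddTableau_card k).mem_toFinset.mp hT⟩)
    ?_ ?_ ?_ ?_
  · intro T hT
    exact Finset.mem_filter.mpr ⟨Finset.mem_univ _, T.2⟩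
  · intro T _ U _ h
    exact Subtype.ext (congrArg (fun V : TableauOfCard k => V.1) h)
  · intro T hT
    exact ⟨⟨T.1, (Finset.mem_filter.mp hT).2⟩, (finite_oddTableau_card k).mem_toFinset.mpr T.2, rfl⟩
  · intro T hT
    rfl

/-! ### Assembly over all degrees -/

theorem hasSum_schurPoly (n : ℕ) :
    HasSum (fun T : OddTableau => (schurPoly n T.1.1 : MvPowerSeries (Fin n) ℚ))
      ((∏ i : Fin n, (1 - MvPowerSeries.X i)) * (1 - ∑ i : Fin n, MvPowerSeries.X i)⁻¹) := by
  refine hasSum_toMvPowerSeries_of_fiber (p := fun T : OddTableau => schurPoly n T.1.1)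
    (d := fun T => T.1.1.card) (fun T => isHomogeneous_schurPoly n T.1.1)
    finite_oddTableau_card ?_
  have h := hasSum_of_recurrence (oddTableauSum_zero n) (oddTableauSum_succ n)
  simp only [← sum_oddTableau_card] at h
  exact h

theorem isCharacterDerivedEnveloping (n : ℕ) :
    IsCharacterDerivedEnveloping n
      ((∏ i : Fin n, (1 - MvPowerSeries.X i)) * (1 - ∑ i : Fin n, MvPowerSeries.X i)⁻¹) := by
  refine ⟨constantsPoly (List.finRange n), fun k a => ?_, ?_⟩
  · rw [eval_constantsPoly a _ (List.nodup_finRange n), List.toFinset_finRange,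
      constantsTrace_univ]
  · rw [Fin.prod_univ_def]
    exact hasSum_constantsPoly _

end NCHarm

end

theorem mainTheorem5 (n : ℕ) :
    ∃ χ : MvPowerSeries (Fin n) ℚ,
      NCHarm.IsCharacterDerivedEnveloping n χ ∧
      χ = (∏ i : Fin n, (1 - MvPowerSeries.X i)) * (1 - ∑ i : Fin n, MvPowerSeries.X i)⁻¹ ∧
      HasSum
        (fun k : ℕ => ∑ i ∈ Finset.Icc 2 k,
          (-1 : MvPowerSeries (Fin n) ℚ) ^ i *
            (NCHarm.elementaryHook n k i : MvPowerSeries (Fin n) ℚ))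
        (χ - 1) ∧
      HasSum
        (fun T : {T : Σ μ : YoungDiagram, NCHarm.StandardTableau μ // Odd T.2.firstMissing} =>
          (NCHarm.schurPoly n T.1.1 : MvPowerSeries (Fin n) ℚ))
        χ :=
  ⟨_, NCHarm.isCharacterDerivedEnveloping n, rfl, NCHarm.hasSum_elementaryHook,
    NCHarm.hasSum_schurPoly n⟩
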